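/- For a positive integer $n$ and $\ell\ge 3$, let $\mathrm{ex}_{\mathcal P}(n,C_\ell)$ denote the largest number of edges in an $n$-vertex planar (simple) graph that contains no cycle of length $\ell$ as a (not necessarily induced) subgraph. A conjecture of Ghosh, Győri, Martin, Paulos and Xiao asserts, for each $\ell\ge 7$, that $\mathrm{ex}_{\mathcal P}(n,C_\ell)\le \frac{3(\ell-1)}{\ell}n-\frac{6(\ell+1)}{\ell}$ for all sufficiently large $n$. Theorem. For each $\ell\ge 11$ this conjecture is false. More precisely, let $\ell\ge 11$ and let $k$ be a positive even integer. (a) If $\ell$ is odd, put $a=\frac{9(\ell-5)(\ell-1)}{(3\ell-13)(\ell-1)-4}$ and $n=\left((5\ell-5)\frac{k}{2}-\ell+3\right)\left(\frac{3(\ell-1)}{2}-5\right)-(5k-4)$. (b) If $\ell$ is even, put $a=\frac{3(3\ell-16)(\ell-1)}{(3\ell-14)(\ell-1)-4}$ and $n=\left((5\ell-5)\frac{k}{2}-\ell+3\right)\left(3\left(\frac{\ell}{2}-1\right)-4\right)-(5k-4)$. In both cases $n$ is a positive integer, there is an $n$-vertex planar graph with no $\ell$-cycle that has exactly $a\left(n-\frac{2(\ell+1)}{\ell-1}\right)$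 edges, and hence $$\mathrm{ex}_{\mathcal P}(n,C_\ell)\ \ge\ a\left(n-\frac{2(\ell+1)}{\ell-1}\right)\ >\ \frac{3(\ell-1)}{\ell}n-\frac{6(\ell+1)}{\ell}.$$ -/

import Mathlib

/-- `A` is an arc in the plane with ends `p` and `q`: the image of an injective continuous path
from `p` to `q`. -/
def IsPlaneArc (p q : ℝ × ℝ) (A : Set (ℝ × ℝ)) : Prop :=
  ∃ γ : Path p q, Function.Injective γ ∧ Set.range γ = A

/-- A drawing of the graph `G` in the plane without crossings: vertices are distinct points, an
edge is an arc between its two ends that contains no other vertex, and two distinct edges meet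
at most in common ends. (The values of `arc` at non-edges are irrelevant.) -/
structure PlaneDrawing {V : Type*} (G : SimpleGraph V) where
  point : V → ℝ × ℝ
  arc : Sym2 V → Set (ℝ × ℝ)
  point_injective : Function.Injective point
  isPlaneArc : ∀ u v : V, G.Adj u v → IsPlaneArc (point u) (point v) (arc s(u, v))
  mem_of_point_mem : ∀ e ∈ G.edgeSet, ∀ w : V, point w ∈ arc e → w ∈ e
  arc_inter : ∀ e ∈ G.edgeSet, ∀ f ∈ G.edgeSet, e ≠ f → ∀ p ∈ arc e ∩ arc f,
    ∃ w : V, w ∈ e ∧ w ∈ f ∧ p = point w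

/-- A graph is planar if it has a drawing in the plane without crossings. -/
def IsPlanarGraph {V : Type*} (G : SimpleGraph V) : Prop :=
  Nonempty (PlaneDrawing G)

open scoped Classical in
/-- The planar Turán number: the largest number of edges in a planar graph on `n` vertices that
contains no copy of `H` as a (not necessarily induced) subgraph. -/
noncomputable def planarTuranNumber (n : ℕ) {W : Type*} (H : SimpleGraph W) : ℕ :=
  Finset.sup (Finset.univ.filter fun G : SimpleGraph (Fin n) => IsPlanarGraph G ∧ H.Free G)
    fun G => G.edgeFinset.card

open Filter Topology

/-! Write ℓ = 2t + 1 + δ with δ ∈ {0, 1}. A block is a plane triangulation with q + 3 = 3t - 4 + δ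
vertices in which at most t vertices meet all edges but at most δ. A cycle has at most two edges at
each of these vertices, so cycles inside a block have length at most 2t + δ < ℓ
(`not_hasCycle_of_cover`), while the block has the full number 3(q + 1) of edges.

Blocks are glued at single vertices. If the corners of a new block are pairwise at distance at least
ℓ in the old graph, no ℓ-cycle arises: one using both parts would contain a path of fewer than ℓ old
edges between two corners (`not_hasCycle_sup`). Distances are bounded below by integer functions
changing by at most 1 along edges. Such a function extends over a block as soon as the three corner
values differ by at most 1, so every distance estimate becomes linear arithmetic on a few joints.

A layer puts ℓ - 1 blocks into an empty triangle x y z: in order they lead from x to y, one of them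
also contains z, and they surround a new empty triangle with the same distance properties
(`IsLayer.next`). A layer contributes 3(q + 1)(ℓ - 1) edges and (q + 2)(ℓ - 1) - 2 vertices. The
quotient a exceeds 3(ℓ - 1)/ℓ exactly when ℓ < q + 4, which holds from ℓ = 11 on. The conjectured
bound is 3(ℓ - 1)/ℓ times the same n - 2(ℓ + 1)/(ℓ - 1), so comparing slopes suffices.

Planarity is certified by heights: the edges are segments below lower edges of a lifted point set,
and lower edges project without crossings. Filling a face means lowering new points slightly below
the lifted triangle, which leaves everything else supported (`Realizable.patch`). -/

/-! ### Planarity from lifted points -/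

/-- The value at `p` of the affine function on the plane with coefficients `c`. -/
def affEval (c : ℝ × ℝ × ℝ) (p : ℝ × ℝ) : ℝ := c.1 * p.1 + c.2.1 * p.2 + c.2.2

/-- Among the points `P 0, …, P (n - 1)` lifted to the heights `h`, some affine function supports
exactly the lifted points with index in `S` from below. -/
def Supported (n : ℕ) (P : ℕ → ℝ × ℝ) (h : ℕ → ℝ) (S : Finset ℕ) : Prop :=
  ∃ c : ℝ × ℝ × ℝ, ∀ v < n, (v ∈ S → affEval c (P v) = h v) ∧ (v ∉ S → affEval c (P v) < h v)

lemma affEval_lineMap (c : ℝ × ℝ × ℝ) (p q : ℝ × ℝ) (s : ℝ) :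
    affEval c (AffineMap.lineMap p q s) = (1 - s) * affEval c p + s * affEval c q := by
  simp only [affEval, AffineMap.lineMap_apply, vsub_eq_sub, vadd_eq_add, Prod.fst_add,
    Prod.snd_add, Prod.smul_fst, Prod.smul_snd, Prod.fst_sub, Prod.snd_sub, smul_eq_mul]
  ring

lemma isPlaneArc_segment {p q : ℝ × ℝ} (hpq : p ≠ q) : IsPlaneArc p q (segment ℝ p q) := by
  refine ⟨⟨⟨fun t => AffineMap.lineMap p q (t : ℝ), ?_⟩, by simp, by simp⟩, ?_, ?_⟩
  · exact AffineMap.lineMap_continuous.comp continuous_subtype_val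
  · intro s t hst
    exact Subtype.ext (AffineMap.lineMap_injective ℝ hpq hst)
  · rw [segment_eq_image_lineMap]
    ext x
    simp [Set.mem_image]

lemma Supported.injective {n : ℕ} {P : ℕ → ℝ × ℝ} {h : ℕ → ℝ}
    (hs : ∀ v < n, Supported n P h {v}) {u v : ℕ} (hu : u < n) (hv : v < n) (huv : P u = P v) :
    u = v := by
  by_contra hne
  obtain ⟨c, hc⟩ := hs u hu
  obtain ⟨d, hd⟩ := hs v hv
  have h1 := (hc u hu).1 (by simp)
  have h2 := (hc v hv).2 (by simp [Ne.symm hne])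
  have h3 := (hd v hv).1 (by simp)
  have h4 := (hd u hu).2 (by simp [hne])
  rw [huv] at h1 h4
  linarith

lemma Supported.le {n : ℕ} {P : ℕ → ℝ × ℝ} {h : ℕ → ℝ} {S : Finset ℕ} {c : ℝ × ℝ × ℝ}
    (hc : ∀ v < n, (v ∈ S → affEval c (P v) = h v) ∧ (v ∉ S → affEval c (P v) < h v)) {v : ℕ}
    (hv : v < n) : affEval c (P v) ≤ h v := by
  by_cases hvS : v ∈ S
  · exact ((hc v hv).1 hvS).le
  · exact ((hc v hv).2 hvS).le

lemma Supported.mem_of_segment {n : ℕ} {P : ℕ → ℝ × ℝ} {h : ℕ → ℝ}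
    {u v w : ℕ} (hu : u < n) (hv : v < n) (hw : w < n) (hsw : Supported n P h {w})
    (hs : Supported n P h {u, v}) (hmem : P w ∈ segment ℝ (P u) (P v)) : w = u ∨ w = v := by
  by_contra! hne
  rw [segment_eq_image_lineMap] at hmem
  obtain ⟨s, ⟨hs0, hs1⟩, hsP⟩ := hmem
  obtain ⟨c, hc⟩ := hs
  obtain ⟨d, hd⟩ := hsw
  have h1 := (hc w hw).2 (by simp [hne])
  have h2 := (hc u hu).1 (by simp)
  have h3 := (hc v hv).1 (by simp)
  have h4 := (hd w hw).1 (by simp)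
  have h5 := Supported.le hd hu
  have h6 := Supported.le hd hv
  rw [← hsP, affEval_lineMap] at h1 h4
  rw [h2, h3] at h1
  nlinarith

/-- At a common point, the support function of each edge bounds the interpolated height of the other
edge from below by that of its own. Hence the two heights agree, and every end of `x y` with
positive weight is touched by the support of `u v`, so it is `u` or `v`. -/
lemma Supported.segment_inter {n : ℕ} {P : ℕ → ℝ × ℝ} {h : ℕ → ℝ}
    {u v x y : ℕ} (hu : u < n) (hv : v < n) (hx : x < n) (hy : y < n)
    (hs : Supported n P h {u, v}) (ht : Supported n P h {x, y}) (hxy : x ≠ y)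
    (hne : s(u, v) ≠ s(x, y)) {p : ℝ × ℝ} (hp : p ∈ segment ℝ (P u) (P v))
    (hq : p ∈ segment ℝ (P x) (P y)) : ∃ w, (w = u ∨ w = v) ∧ (w = x ∨ w = y) ∧ p = P w := by
  rw [segment_eq_image_lineMap] at hp hq
  obtain ⟨s, ⟨hs0, hs1⟩, hsP⟩ := hp
  obtain ⟨t, ⟨ht0, ht1⟩, htP⟩ := hq
  obtain ⟨c, hc⟩ := hs
  obtain ⟨d, hd⟩ := ht
  have c1 := (hc u hu).1 (by simp)
  have c2 := (hc v hv).1 (by simp)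
  have c3 := Supported.le hc hx
  have c4 := Supported.le hc hy
  have d1 := (hd x hx).1 (by simp)
  have d2 := (hd y hy).1 (by simp)
  have d3 := Supported.le hd hu
  have d4 := Supported.le hd hv
  have e1 : (1 - s) * h u + s * h v = (1 - t) * affEval c (P x) + t * affEval c (P y) := by
    rw [← affEval_lineMap, htP, ← hsP, affEval_lineMap, c1, c2]
  have e2 : (1 - t) * h x + t * h y = (1 - s) * affEval d (P u) + s * affEval d (P v) := by
    rw [← affEval_lineMap, hsP, ← htP, affEval_lineMap, d1, d2]
  have m1 := mul_le_mul_of_nonneg_left c3 (sub_nonneg.2 ht1)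
  have m2 := mul_le_mul_of_nonneg_left c4 ht0
  have m3 := mul_le_mul_of_nonneg_left d3 (sub_nonneg.2 hs1)
  have m4 := mul_le_mul_of_nonneg_left d4 hs0
  have k1 : (1 - t) * (h x - affEval c (P x)) = 0 := by linarith
  have k2 : t * (h y - affEval c (P y)) = 0 := by linarith
  have hx' : 1 - t ≠ 0 → x = u ∨ x = v := by
    intro h0
    by_contra hcon
    have := (hc x hx).2 (by simpa using hcon)
    rcases mul_eq_zero.1 k1 with h | h
    · exact h0 h
    · linarith
  have hy' : t ≠ 0 → y = u ∨ y = v := by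
    intro h0
    by_contra hcon
    have := (hc y hy).2 (by simpa using hcon)
    rcases mul_eq_zero.1 k2 with h | h
    · exact h0 h
    · linarith
  by_cases t0 : t = 0
  · refine ⟨x, hx' (by simp [t0]), Or.inl rfl, ?_⟩
    rw [← htP, t0]; simp
  by_cases t1 : 1 - t = 0
  · refine ⟨y, hy' t0, Or.inr rfl, ?_⟩
    have : t = 1 := by linarith
    rw [← htP, this]; simp
  exfalso
  apply hne
  rcases hx' t1 with rfl | rfl <;> rcases hy' t0 with rfl | rfl
  · exact absurd rfl hxy
  · rfl
  · exact Sym2.eq_swap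
  · exact absurd rfl hxy

theorem isPlanarGraph_of_supported {n : ℕ} {P : ℕ → ℝ × ℝ} {h : ℕ → ℝ}
    (hs : ∀ v < n, Supported n P h {v}) (G : SimpleGraph (Fin n))
    (hG : ∀ u v, G.Adj u v → Supported n P h {(u : ℕ), (v : ℕ)}) : IsPlanarGraph G := by
  have hinj : Function.Injective fun v : Fin n => P v := fun u v huv =>
    Fin.ext (Supported.injective hs u.2 v.2 huv)
  refine ⟨⟨fun v => P v, Sym2.lift ⟨fun u v => segment ℝ (P u) (P v), fun u v =>
    segment_symm ℝ _ _⟩, hinj, ?_, ?_, ?_⟩⟩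
  · intro u v huv
    exact isPlaneArc_segment (hinj.ne huv.ne)
  · intro e
    induction e with | _ u v
    intro he w hw
    rw [Sym2.mem_iff, Fin.ext_iff, Fin.ext_iff]
    exact Supported.mem_of_segment u.2 v.2 w.2 (hs w w.2) (hG u v he) hw
  · intro e
    induction e with | _ u v
    intro he f
    induction f with | _ x y
    intro hf hne p hp
    have hne' : s((u : ℕ), (v : ℕ)) ≠ s((x : ℕ), (y : ℕ)) := by
      intro h0
      apply hne
      simpa [Sym2.eq_iff, Fin.ext_iff] using h0
    obtain ⟨w, hw1, hw2, hw3⟩ := Supported.segment_inter u.2 v.2 x.2 y.2 (hG u v he) (hG x y hf)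
      (by simpa [Fin.ext_iff] using hf.ne) hne' hp.1 hp.2
    have hwn : w < n := by rcases hw1 with rfl | rfl <;> exact Fin.is_lt _
    refine ⟨⟨w, hwn⟩, ?_, ?_, hw3⟩ <;> simpa [Fin.ext_iff]

/-! ### Subdividing a triangular face -/

/-- Twice the signed area of the triangle `p q r`. -/
def cross (p q r : ℝ × ℝ) : ℝ := (q.1 - p.1) * (r.2 - p.2) - (q.2 - p.2) * (r.1 - p.1)

/-- The set of the three entries of a triple. -/
def triSet (T : ℕ × ℕ × ℕ) : Finset ℕ := {T.1, T.2.1, T.2.2}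

/-- The numbers `0, …, n - 1` can be placed as points of the plane and lifted to space so that all
points and all edges of `H` are supported from below, and so are the triangles listed in `F`,
which are nondegenerate and pairwise different. -/
def Realizable (n : ℕ) (H : SimpleGraph ℕ) (F : List (ℕ × ℕ × ℕ)) : Prop :=
  ∃ (P : ℕ → ℝ × ℝ) (h : ℕ → ℝ),
    (∀ v < n, Supported n P h {v}) ∧
    (∀ u v, H.Adj u v → u < n ∧ v < n ∧ Supported n P h {u, v}) ∧
    (∀ T ∈ F, (T.1 < n ∧ T.2.1 < n ∧ T.2.2 < n) ∧ cross (P T.1) (P T.2.1) (P T.2.2) ≠ 0 ∧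
      Supported n P h (triSet T)) ∧
    (F.map triSet).Nodup

lemma exists_affEval_eq {p q r : ℝ × ℝ} (hd : cross p q r ≠ 0) (x y z : ℝ) :
    ∃ c, affEval c p = x ∧ affEval c q = y ∧ affEval c r = z := by
  set D := cross p q r with hD
  let A := ((y - x) * (r.2 - p.2) - (q.2 - p.2) * (z - x)) / D
  let B := ((q.1 - p.1) * (z - x) - (y - x) * (r.1 - p.1)) / D
  have hA : A * D = (y - x) * (r.2 - p.2) - (q.2 - p.2) * (z - x) := div_mul_cancel₀ _ hd
  have hB : B * D = (q.1 - p.1) * (z - x) - (y - x) * (r.1 - p.1) := div_mul_cancel₀ _ hd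
  refine ⟨(A, B, x - A * p.1 - B * p.2), ?_, ?_, ?_⟩
  · simp only [affEval]; ring
  · simp only [affEval]
    apply mul_left_cancel₀ hd
    simp only [cross] at hD
    linear_combination (q.1 - p.1) * hA + (q.2 - p.2) * hB + (x - y) * hD
  · simp only [affEval]
    apply mul_left_cancel₀ hd
    simp only [cross] at hD
    linear_combination (r.1 - p.1) * hA + (r.2 - p.2) * hB + (x - z) * hD

/-- The sum of `x, y, z` with weights `w`. -/
def dot (w : ℝ × ℝ × ℝ) (x y z : ℝ) : ℝ := w.1 * x + w.2.1 * y + w.2.2 * z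

/-- The combination of the points `p, q, r` with weights `w`. -/
def comb (w : ℝ × ℝ × ℝ) (p q r : ℝ × ℝ) : ℝ × ℝ := (dot w p.1 q.1 r.1, dot w p.2 q.2 r.2)

lemma affEval_comb (c : ℝ × ℝ × ℝ) {w : ℝ × ℝ × ℝ} (hw : w.1 + w.2.1 + w.2.2 = 1)
    (p q r : ℝ × ℝ) :
    affEval c (comb w p q r) = dot w (affEval c p) (affEval c q) (affEval c r) := by
  simp only [affEval, comb, dot]
  linear_combination (-c.2.2) * hw

/-- The determinant of three weight vectors. -/
def wdet (u v w : ℝ × ℝ × ℝ) : ℝ :=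
  dot u (v.2.1 * w.2.2 - v.2.2 * w.2.1) (v.2.2 * w.1 - v.1 * w.2.2) (v.1 * w.2.1 - v.2.1 * w.1)

lemma cross_comb {u v w : ℝ × ℝ × ℝ} (hu : u.1 + u.2.1 + u.2.2 = 1)
    (hv : v.1 + v.2.1 + v.2.2 = 1) (hw : w.1 + w.2.1 + w.2.2 = 1) (p q r : ℝ × ℝ) :
    cross (comb u p q r) (comb v p q r) (comb w p q r) = wdet u v w * cross p q r := by
  obtain ⟨u1, u2, u3⟩ := u
  obtain ⟨v1, v2, v3⟩ := v
  obtain ⟨w1, w2, w3⟩ := w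
  obtain rfl : u1 = 1 - u2 - u3 := by simp only at hu; linarith
  obtain rfl : v1 = 1 - v2 - v3 := by simp only at hv; linarith
  obtain rfl : w1 = 1 - w2 - w3 := by simp only at hw; linarith
  simp only [cross, comb, wdet, dot]
  ring

/-- The local set `S` of a patch with weights `W` and drops `η` is supported by `μ`. -/
def LocalSupport (W : ℕ → ℝ × ℝ × ℝ) (η : ℕ → ℝ) (k : ℕ) (S : Finset ℕ) : Prop :=
  ∃ x y z : ℝ, ∀ j < k, (j ∈ S → dot (W j) x y z = η j) ∧ (j ∉ S → η j < dot (W j) x y z)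

/-- A regular subdivision of a triangle with corners `0, 1, 2` and further vertices
`3, …, r + 2` in its interior, given by barycentric coordinates `W`, with the triangles `N`. It is
induced by lowering vertex `j` by `η j`. -/
structure IsPatch (r : ℕ) (W : ℕ → ℝ × ℝ × ℝ) (η : ℕ → ℝ) (N : List (ℕ × ℕ × ℕ)) : Prop where
  zero : W 0 = (1, 0, 0)
  one : W 1 = (0, 1, 0)
  two : W 2 = (0, 0, 1)
  pos : ∀ j, 3 ≤ j → j < 3 + r → 0 < (W j).1 ∧ 0 < (W j).2.1 ∧ 0 < (W j).2.2
  sum : ∀ j < 3 + r, (W j).1 + (W j).2.1 + (W j).2.2 = 1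
  drop : ∀ j < 3, η j = 0
  single : ∀ j, 3 ≤ j → j < 3 + r → LocalSupport W η (3 + r) {j}
  lt : ∀ T ∈ N, T.1 < 3 + r ∧ T.2.1 < 3 + r ∧ T.2.2 < 3 + r
  det : ∀ T ∈ N, wdet (W T.1) (W T.2.1) (W T.2.2) ≠ 0
  face : ∀ T ∈ N, LocalSupport W η (3 + r) (triSet T)
  new : ∀ T ∈ N, 3 ≤ T.1 ∨ 3 ≤ T.2.1 ∨ 3 ≤ T.2.2
  nodup : (N.map triSet).Nodup

/-- The vertex with local index `j` of a patch in the triangle `a b c`, the interior vertices being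
numbered from `n`. -/
def patchVertex (a b c n j : ℕ) : ℕ :=
  if j = 0 then a else if j = 1 then b else if j = 2 then c else n + (j - 3)

lemma patchVertex_cases (a b c n j : ℕ) :
    (j = 0 ∧ patchVertex a b c n j = a) ∨ (j = 1 ∧ patchVertex a b c n j = b) ∨
      (j = 2 ∧ patchVertex a b c n j = c) ∨ (3 ≤ j ∧ patchVertex a b c n j = n + (j - 3)) := by
  match j with
  | 0 | 1 | 2 => simp [patchVertex]
  | j + 3 => simp [patchVertex]

lemma patchVertex_sub_add {n v : ℕ} (a b c : ℕ) (hv : n ≤ v) :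
    patchVertex a b c n (v - n + 3) = v := by
  rcases patchVertex_cases a b c n (v - n + 3) with h | h | h | h <;> omega

/-- The triple of vertices with the given local indices. -/
def patchTriple (a b c n : ℕ) (T : ℕ × ℕ × ℕ) : ℕ × ℕ × ℕ :=
  (patchVertex a b c n T.1, patchVertex a b c n T.2.1, patchVertex a b c n T.2.2)

lemma triSet_patchTriple (a b c n : ℕ) (T : ℕ × ℕ × ℕ) :
    triSet (patchTriple a b c n T) = (triSet T).image (patchVertex a b c n) := by
  simp [triSet, patchTriple, Finset.image_insert]

lemma patchVertex_injective {a b c n : ℕ} (ha : a < n) (hb : b < n) (hc : c < n) (hab : a ≠ b)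
    (hac : a ≠ c) (hbc : b ≠ c) : Function.Injective (patchVertex a b c n) := by
  intro i j hij
  simp only [patchVertex] at hij
  split_ifs at hij <;> omega

lemma cross_ne {P : ℕ → ℝ × ℝ} {a b c : ℕ} (h : cross (P a) (P b) (P c) ≠ 0) :
    a ≠ b ∧ a ≠ c ∧ b ≠ c := by
  refine ⟨?_, ?_, ?_⟩ <;> rintro rfl <;> apply h <;> simp only [cross] <;> ring

lemma eventually_mul_lt {A B : ℝ} (hB : 0 < B) : ∀ᶠ ε in 𝓝[>] (0 : ℝ), ε * A < B := by
  have : Tendsto (fun ε : ℝ => ε * A) (𝓝 0) (𝓝 (0 * A)) :=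
    (continuous_id.mul continuous_const).tendsto 0
  rw [zero_mul] at this
  exact (this.mono_left nhdsWithin_le_nhds).eventually_lt_const hB

lemma affEval_sub (c d : ℝ × ℝ × ℝ) (ε : ℝ) (p : ℝ × ℝ) :
    affEval (c.1 - ε * d.1, c.2.1 - ε * d.2.1, c.2.2 - ε * d.2.2) p =
      affEval c p - ε * affEval d p := by
  simp only [affEval]; ring

/-- The positions after a patch with weights `W` has been inserted. -/
def patchPos (n : ℕ) (P : ℕ → ℝ × ℝ) (a b c : ℕ) (W : ℕ → ℝ × ℝ × ℝ) (v : ℕ) : ℝ × ℝ :=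
  if v < n then P v else comb (W (v - n + 3)) (P a) (P b) (P c)

/-- The heights after a patch with weights `W` and drops `ε * η` has been inserted. -/
def patchHeight (n : ℕ) (h : ℕ → ℝ) (a b c : ℕ) (W : ℕ → ℝ × ℝ × ℝ) (η : ℕ → ℝ) (ε : ℝ) (v : ℕ) :
    ℝ :=
  if v < n then h v else dot (W (v - n + 3)) (h a) (h b) (h c) - ε * η (v - n + 3)

section
variable {n a b c r : ℕ} {P : ℕ → ℝ × ℝ} {h : ℕ → ℝ} {W : ℕ → ℝ × ℝ × ℝ} {η : ℕ → ℝ}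
  {N : List (ℕ × ℕ × ℕ)}

lemma IsPatch.pos_vertex (hp : IsPatch r W η N) (ha : a < n) (hb : b < n) (hc : c < n) (j : ℕ) :
    patchPos n P a b c W (patchVertex a b c n j) = comb (W j) (P a) (P b) (P c) := by
  rcases patchVertex_cases a b c n j with ⟨rfl, h⟩ | ⟨rfl, h⟩ | ⟨rfl, h⟩ | ⟨h3, h⟩ <;> rw [h]
  · simp [patchPos, ha, hp.zero, comb, dot]
  · simp [patchPos, hb, hp.one, comb, dot]
  · simp [patchPos, hc, hp.two, comb, dot]
  · rw [patchPos, if_neg (by omega), show n + (j - 3) - n + 3 = j by omega]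

lemma IsPatch.height_vertex (hp : IsPatch r W η N) (ha : a < n) (hb : b < n) (hc : c < n)
    (ε : ℝ) (j : ℕ) :
    patchHeight n h a b c W η ε (patchVertex a b c n j) =
      dot (W j) (h a) (h b) (h c) - ε * η j := by
  rcases patchVertex_cases a b c n j with ⟨rfl, h⟩ | ⟨rfl, h⟩ | ⟨rfl, h⟩ | ⟨h3, h⟩ <;> rw [h]
  · simp [patchHeight, ha, hp.zero, dot, hp.drop]
  · simp [patchHeight, hb, hp.one, dot, hp.drop]
  · simp [patchHeight, hc, hp.two, dot, hp.drop]
  · rw [patchHeight, if_neg (by omega), show n + (j - 3) - n + 3 = j by omega]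

/-- The old support function still works. Some corner is outside `S`, so it lies strictly above this
function; the weights of interior vertices are positive, so these start strictly above as well, and
a small drop keeps them there. -/
lemma IsPatch.supported_of_old (hp : IsPatch r W η N) (ha : a < n) (hb : b < n) (hc : c < n)
    {S : Finset ℕ} (hS : S ⊆ Finset.range n) (hn : ¬ (a ∈ S ∧ b ∈ S ∧ c ∈ S))
    (hs : Supported n P h S) : ∀ᶠ ε in 𝓝[>] (0 : ℝ),
      Supported (n + r) (patchPos n P a b c W) (patchHeight n h a b c W η ε) S := by
  obtain ⟨g, hg⟩ := hs
  have key : ∀ j ∈ Finset.Ico 3 (3 + r), ∀ᶠ ε in 𝓝[>] (0 : ℝ),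
      ε * η j < dot (W j) (h a - affEval g (P a)) (h b - affEval g (P b))
        (h c - affEval g (P c)) := by
    intro j hj
    rw [Finset.mem_Ico] at hj
    apply eventually_mul_lt
    obtain ⟨p1, p2, p3⟩ := hp.pos j hj.1 hj.2
    have l1 := mul_nonneg p1.le (sub_nonneg.2 (Supported.le hg ha))
    have l2 := mul_nonneg p2.le (sub_nonneg.2 (Supported.le hg hb))
    have l3 := mul_nonneg p3.le (sub_nonneg.2 (Supported.le hg hc))
    simp only [dot]
    by_cases haS : a ∈ S
    · by_cases hbS : b ∈ S
      · have := mul_pos p3 (sub_pos.2 ((hg c hc).2 fun h => hn ⟨haS, hbS, h⟩))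
        linarith
      · have := mul_pos p2 (sub_pos.2 ((hg b hb).2 hbS))
        linarith
    · have := mul_pos p1 (sub_pos.2 ((hg a ha).2 haS))
      linarith
  rw [← Filter.eventually_all_finset] at key
  filter_upwards [key] with ε hε
  refine ⟨g, fun v hv => ?_⟩
  by_cases hvn : v < n
  · simpa [patchPos, patchHeight, hvn] using hg v hvn
  · have hvS : v ∉ S := fun h => hvn (Finset.mem_range.1 (hS h))
    refine ⟨fun h => absurd h hvS, fun _ => ?_⟩
    have := hε (v - n + 3) (by rw [Finset.mem_Ico]; omega)
    simp only [patchPos, patchHeight, hvn, if_false]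
    rw [affEval_comb g (hp.sum _ (by omega))]
    simp only [dot] at this ⊢
    linarith

/-- Subtract from the support function of the face `ε` times the affine function with corner values
`x, y, z`. Inside the face the comparison of heights becomes `ε` times the local one; all other
points have a positive gap, which survives for small `ε`. -/
lemma IsPatch.supported_of_local (hp : IsPatch r W η N) (ha : a < n) (hb : b < n) (hc : c < n)
    (hd : cross (P a) (P b) (P c) ≠ 0) (hs : Supported n P h {a, b, c}) {S : Finset ℕ}
    (hS : LocalSupport W η (3 + r) S) : ∀ᶠ ε in 𝓝[>] (0 : ℝ),
      Supported (n + r) (patchPos n P a b c W) (patchHeight n h a b c W η ε)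
        (S.image (patchVertex a b c n)) := by
  obtain ⟨g, hg⟩ := hs
  obtain ⟨x, y, z, hxyz⟩ := hS
  obtain ⟨m, m1, m2, m3⟩ := exists_affEval_eq hd x y z
  obtain ⟨hab, hac, hbc⟩ := cross_ne hd
  have hinj := patchVertex_injective ha hb hc hab hac hbc
  have g1 := (hg a ha).1 (by simp)
  have g2 := (hg b hb).1 (by simp)
  have g3 := (hg c hc).1 (by simp)
  have key : ∀ v ∈ (Finset.range n).filter (fun v => v ∉ ({a, b, c} : Finset ℕ)),
      ∀ᶠ ε in 𝓝[>] (0 : ℝ), ε * (- affEval m (P v)) < h v - affEval g (P v) := by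
    intro v hv
    rw [Finset.mem_filter, Finset.mem_range] at hv
    exact eventually_mul_lt (sub_pos.2 ((hg v hv.1).2 hv.2))
  rw [← Filter.eventually_all_finset] at key
  filter_upwards [key, self_mem_nhdsWithin] with ε hε hε0
  rw [Set.mem_Ioi] at hε0
  refine ⟨(g.1 - ε * m.1, g.2.1 - ε * m.2.1, g.2.2 - ε * m.2.2), fun v hv => ?_⟩
  by_cases hloc : ∃ j < 3 + r, v = patchVertex a b c n j
  · obtain ⟨j, hj, rfl⟩ := hloc
    rw [affEval_sub, hp.pos_vertex ha hb hc, hp.height_vertex ha hb hc,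
      affEval_comb g (hp.sum j hj), affEval_comb m (hp.sum j hj), g1, g2, g3, m1, m2, m3]
    obtain ⟨e1, e2⟩ := hxyz j hj
    rw [Finset.mem_image]
    constructor
    · rintro ⟨i, hi, hij⟩
      rw [hinj hij] at hi
      rw [e1 hi]
    · intro hn
      have := mul_lt_mul_of_pos_left (e2 fun h => hn ⟨j, h, rfl⟩) hε0
      linarith
  · have hv1 : v < n := by
      by_contra hvn
      exact hloc ⟨v - n + 3, by omega, (patchVertex_sub_add a b c (not_lt.1 hvn)).symm⟩
    have hv2 : v ∉ ({a, b, c} : Finset ℕ) := by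
      simp only [Finset.mem_insert, Finset.mem_singleton]
      rintro (rfl | rfl | rfl)
      · exact hloc ⟨0, by omega, by simp [patchVertex]⟩
      · exact hloc ⟨1, by omega, by simp [patchVertex]⟩
      · exact hloc ⟨2, by omega, by simp [patchVertex]⟩
    have := hε v (by rw [Finset.mem_filter, Finset.mem_range]; exact ⟨hv1, hv2⟩)
    have hlt : affEval (g.1 - ε * m.1, g.2.1 - ε * m.2.1, g.2.2 - ε * m.2.2)
        (patchPos n P a b c W v) < patchHeight n h a b c W η ε v := by
      rw [affEval_sub]
      simp only [patchPos, patchHeight, hv1, if_true]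
      linarith
    by_cases hvS : v ∈ S.image (patchVertex a b c n)
    · exfalso
      rw [Finset.mem_image] at hvS
      obtain ⟨j, -, rfl⟩ := hvS
      apply hloc
      refine ⟨j, ?_, rfl⟩
      by_contra hj
      simp only [patchVertex] at hv1
      split_ifs at hv1 <;> omega
    · exact ⟨fun h => absurd h hvS, fun _ => hlt⟩

end

theorem Realizable.patch {n a b c r : ℕ} {H : SimpleGraph ℕ} {F N : List (ℕ × ℕ × ℕ)}
    {W : ℕ → ℝ × ℝ × ℝ} {η : ℕ → ℝ} (hR : Realizable n H ((a, b, c) :: F))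
    (hp : IsPatch r W η N) : Realizable (n + r) H (N.map (patchTriple a b c n) ++ F) := by
  obtain ⟨P, h, hv, he, hf, hnd⟩ := hR
  obtain ⟨⟨ha, hb, hc⟩, hd, hs⟩ := hf (a, b, c) (by simp)
  dsimp only at ha hb hc hd
  replace hs : Supported n P h {a, b, c} := hs
  obtain ⟨hab, hac, hbc⟩ := cross_ne hd
  have hinj := patchVertex_injective ha hb hc hab hac hbc
  have hcard : ({a, b, c} : Finset ℕ).card = 3 := by
    rw [Finset.card_eq_three]; exact ⟨a, b, c, hab, hac, hbc, rfl⟩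
  -- How small `ε` must be depends on the set, but only finitely many sets occur, so one `ε` serves
  -- all of them.
  have hold : ∀ S ∈ (Finset.range n).powerset, ∀ᶠ ε in 𝓝[>] (0 : ℝ),
      Supported n P h S → ¬ (a ∈ S ∧ b ∈ S ∧ c ∈ S) →
      Supported (n + r) (patchPos n P a b c W) (patchHeight n h a b c W η ε) S := by
    intro S hS
    by_cases h1 : Supported n P h S ∧ ¬ (a ∈ S ∧ b ∈ S ∧ c ∈ S)
    · filter_upwards [hp.supported_of_old ha hb hc (Finset.mem_powerset.1 hS) h1.2 h1.1] with ε hε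
      exact fun _ _ => hε
    · exact Eventually.of_forall fun ε h2 h3 => absurd ⟨h2, h3⟩ h1
  rw [← Filter.eventually_all_finset] at hold
  have hsing : ∀ j ∈ Finset.Ico 3 (3 + r), ∀ᶠ ε in 𝓝[>] (0 : ℝ),
      Supported (n + r) (patchPos n P a b c W) (patchHeight n h a b c W η ε)
        (({j} : Finset ℕ).image (patchVertex a b c n)) := by
    intro j hj
    rw [Finset.mem_Ico] at hj
    exact hp.supported_of_local ha hb hc hd hs (hp.single j hj.1 hj.2)
  rw [← Filter.eventually_all_finset] at hsing
  have hfaces : ∀ T ∈ N.toFinset, ∀ᶠ ε in 𝓝[>] (0 : ℝ),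
      Supported (n + r) (patchPos n P a b c W) (patchHeight n h a b c W η ε)
        ((triSet T).image (patchVertex a b c n)) := fun T hT =>
    hp.supported_of_local ha hb hc hd hs (hp.face T (List.mem_toFinset.1 hT))
  rw [← Filter.eventually_all_finset] at hfaces
  obtain ⟨ε, h1, h2, h3⟩ := (hold.and (hsing.and hfaces)).exists
  have hposold : ∀ v < n, patchPos n P a b c W v = P v := fun v hv => by simp [patchPos, hv]
  have hlt : ∀ j < 3 + r, patchVertex a b c n j < n + r := by
    intro j hj
    simp only [patchVertex]
    split_ifs <;> omega
  refine ⟨patchPos n P a b c W, patchHeight n h a b c W η ε, ?_, ?_, ?_, ?_⟩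
  · intro v hvr
    by_cases hvn : v < n
    · refine h1 _ (by simpa using hvn) (hv v hvn) ?_
      simp only [Finset.mem_singleton]
      omega
    · have := h2 (v - n + 3) (by rw [Finset.mem_Ico]; omega)
      rw [Finset.image_singleton] at this
      rwa [patchVertex_sub_add a b c (not_lt.1 hvn)] at this
  · intro u v huv
    obtain ⟨hu, hv, hs⟩ := he u v huv
    refine ⟨by omega, by omega, h1 _ ?_ hs ?_⟩
    · rw [Finset.mem_powerset]
      intro x hx
      simp only [Finset.mem_insert, Finset.mem_singleton] at hx
      rw [Finset.mem_range]
      omega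
    · simp only [Finset.mem_insert, Finset.mem_singleton]
      omega
  · intro T hT
    rw [List.mem_append] at hT
    rcases hT with hT | hT
    · obtain ⟨T', hT', rfl⟩ := List.mem_map.1 hT
      obtain ⟨l1, l2, l3⟩ := hp.lt T' hT'
      refine ⟨⟨hlt _ l1, hlt _ l2, hlt _ l3⟩, ?_, ?_⟩
      · simp only [patchTriple]
        rw [hp.pos_vertex ha hb hc, hp.pos_vertex ha hb hc, hp.pos_vertex ha hb hc,
          cross_comb (hp.sum _ l1) (hp.sum _ l2) (hp.sum _ l3)]
        exact mul_ne_zero (hp.det T' hT') hd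
      · rw [triSet_patchTriple]
        exact h3 T' (List.mem_toFinset.2 hT')
    · obtain ⟨⟨t1, t2, t3⟩, hd', hs'⟩ := hf T (List.mem_cons_of_mem _ hT)
      refine ⟨⟨by omega, by omega, by omega⟩, ?_, ?_⟩
      · rwa [hposold _ t1, hposold _ t2, hposold _ t3]
      · refine h1 _ ?_ hs' ?_
        · rw [Finset.mem_powerset]
          intro x hx
          simp only [triSet, Finset.mem_insert, Finset.mem_singleton] at hx
          rw [Finset.mem_range]
          omega
        · rintro ⟨q1, q2, q3⟩
          -- A remaining face that contains all three corners would be the filled face itself, which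
          -- is listed only once.
          have hsub : ({a, b, c} : Finset ℕ) ⊆ triSet T := by
            intro x hx
            simp only [Finset.mem_insert, Finset.mem_singleton] at hx
            rcases hx with rfl | rfl | rfl <;> assumption
          have heq := Finset.eq_of_subset_of_card_le hsub (by rw [hcard]; exact Finset.card_le_three)
          rw [List.map_cons, List.nodup_cons] at hnd
          exact hnd.1 (List.mem_map.2 ⟨T, hT, heq.symm⟩)
  · rw [List.map_append, List.nodup_append]
    refine ⟨?_, (List.nodup_cons.1 hnd).2, ?_⟩
    · rw [List.map_map]
      have : (triSet ∘ patchTriple a b c n) =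
          (fun S : Finset ℕ => S.image (patchVertex a b c n)) ∘ triSet := by
        funext T
        exact triSet_patchTriple a b c n T
      rw [this, ← List.map_map]
      exact hp.nodup.map (Finset.image_injective hinj)
    · intro S hS S' hS' heq
      subst heq
      obtain ⟨T, hT, rfl⟩ := List.mem_map.1 hS
      obtain ⟨T', hT', rfl⟩ := List.mem_map.1 hT
      obtain ⟨U, hU, hUT⟩ := List.mem_map.1 hS'
      obtain ⟨⟨t1, t2, t3⟩, -, -⟩ := hf U (List.mem_cons_of_mem _ hU)
      have hbd : ∀ x ∈ triSet U, x < n := by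
        intro x hx
        simp only [triSet, Finset.mem_insert, Finset.mem_singleton] at hx
        omega
      rw [hUT] at hbd
      have hge : ∀ j, 3 ≤ j → n ≤ patchVertex a b c n j := by
        intro j hj
        simp only [patchVertex]
        split_ifs <;> omega
      rcases hp.new T' hT' with h0 | h0 | h0
      · exact absurd (hbd _ (by simp [triSet, patchTriple])) (not_lt.2 (hge _ h0))
      · exact absurd (hbd _ (by simp [triSet, patchTriple])) (not_lt.2 (hge _ h0))
      · exact absurd (hbd _ (by simp [triSet, patchTriple])) (not_lt.2 (hge _ h0))

/-! ### The two patches: a single vertex and an octahedron -/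

lemma isPatch_stack : IsPatch 1
    (fun j => if j = 0 then (1, 0, 0) else if j = 1 then (0, 1, 0) else if j = 2 then (0, 0, 1)
      else (1 / 3, 1 / 3, 1 / 3))
    (fun j => if j < 3 then 0 else 1) [(3, 1, 2), (0, 3, 2), (0, 1, 3)] where
  zero := by simp
  one := by simp
  two := by simp
  pos := by intro j h1 h2; interval_cases j; norm_num
  sum := by intro j h; interval_cases j <;> norm_num
  drop := by intro j h; simp [h]
  single := by
    intro j h1 h2
    interval_cases j
    refine ⟨1, 1, 1, fun i hi => ?_⟩
    interval_cases i <;> norm_num [dot]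
  lt := by simp
  det := by norm_num [wdet, dot]
  face := by
    simp only [List.forall_mem_cons, List.not_mem_nil, false_imp_iff, implies_true, and_true]
    refine ⟨⟨3, 0, 0, ?_⟩, ⟨0, 3, 0, ?_⟩, ⟨0, 0, 3, ?_⟩⟩ <;> intro i hi <;>
      interval_cases i <;> norm_num [dot, triSet]
  new := by simp
  nodup := by decide

/-- Each interior vertex lies close to the side opposite to one corner. With equal drops the inner
triangle is flat and the remaining lower faces are the other six faces of an octahedron. -/
lemma isPatch_octa : IsPatch 3
    (fun j => if j = 0 then (1, 0, 0) else if j = 1 then (0, 1, 0) else if j = 2 then (0, 0, 1)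
      else if j = 3 then (1 / 7, 3 / 7, 3 / 7) else if j = 4 then (3 / 7, 1 / 7, 3 / 7)
      else (3 / 7, 3 / 7, 1 / 7))
    (fun j => if j < 3 then 0 else 1)
    [(0, 4, 5), (1, 3, 5), (2, 3, 4), (3, 4, 5), (5, 0, 1), (4, 0, 2), (3, 1, 2)] where
  zero := by simp
  one := by simp
  two := by simp
  pos := by intro j h1 h2; interval_cases j <;> norm_num
  sum := by intro j h; interval_cases j <;> norm_num
  drop := by intro j h; simp [h]
  single := by
    intro j h1 h2
    interval_cases j
    · refine ⟨7 / 4, 7 / 8, 7 / 8, fun i hi => ?_⟩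
      interval_cases i <;> norm_num [dot]
    · refine ⟨7 / 8, 7 / 4, 7 / 8, fun i hi => ?_⟩
      interval_cases i <;> norm_num [dot]
    · refine ⟨7 / 8, 7 / 8, 7 / 4, fun i hi => ?_⟩
      interval_cases i <;> norm_num [dot]
  lt := by simp
  det := by norm_num [wdet, dot]
  face := by
    simp only [List.forall_mem_cons, List.not_mem_nil, false_imp_iff, implies_true, and_true]
    refine ⟨⟨0, 7 / 4, 7 / 4, ?_⟩, ⟨7 / 4, 0, 7 / 4, ?_⟩, ⟨7 / 4, 7 / 4, 0, ?_⟩, ⟨1, 1, 1, ?_⟩,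
      ⟨0, 0, 7, ?_⟩, ⟨0, 7, 0, ?_⟩, ⟨7, 0, 0, ?_⟩⟩ <;> intro i hi <;>
      interval_cases i <;> norm_num [dot, triSet]
  new := by simp
  nodup := by decide

/-! ### Operations on faces and edges of a drawing -/

section
variable {n a b c : ℕ} {H : SimpleGraph ℕ} {F : List (ℕ × ℕ × ℕ)}

lemma Realizable.stack (hR : Realizable n H ((a, b, c) :: F)) :
    Realizable (n + 1) H ((n, b, c) :: (a, n, c) :: (a, b, n) :: F) := by
  simpa [patchTriple, patchVertex] using hR.patch isPatch_stack

lemma Realizable.octa (hR : Realizable n H ((a, b, c) :: F)) :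
    Realizable (n + 3) H ((a, n + 1, n + 2) :: (b, n, n + 2) :: (c, n, n + 1) ::
      (n, n + 1, n + 2) :: (n + 2, a, b) :: (n + 1, a, c) :: (n, b, c) :: F) := by
  simpa [patchTriple, patchVertex] using hR.patch isPatch_octa

lemma Realizable.lt (hR : Realizable n H F) {u v : ℕ} (h : H.Adj u v) : u < n ∧ v < n := by
  obtain ⟨P, h, hv, he, -, -⟩ := hR
  exact ⟨(he u v ‹_›).1, (he u v ‹_›).2.1⟩

lemma Realizable.face_lt {T : ℕ × ℕ × ℕ} (hR : Realizable n H F) (hT : T ∈ F) :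
    T.1 < n ∧ T.2.1 < n ∧ T.2.2 < n := by
  obtain ⟨P, h, -, -, hf, -⟩ := hR
  exact (hf T hT).1

lemma Realizable.face_ne {T : ℕ × ℕ × ℕ} (hR : Realizable n H F) (hT : T ∈ F) :
    T.1 ≠ T.2.1 ∧ T.1 ≠ T.2.2 ∧ T.2.1 ≠ T.2.2 := by
  obtain ⟨P, h, -, -, hf, -⟩ := hR
  exact cross_ne (hf T hT).2.1

lemma Realizable.mono {F' : List (ℕ × ℕ × ℕ)} (hR : Realizable n H F) (hF : F'.Subperm F) :
    Realizable n H F' := by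
  obtain ⟨P, h, hv, he, hf, hnd⟩ := hR
  refine ⟨P, h, hv, he, fun T hT => hf T (hF.subset hT), ?_⟩
  obtain ⟨L, hL, hsub⟩ := hF
  exact ((hL.map triSet).nodup_iff).1 (hnd.sublist (hsub.map triSet))

lemma Realizable.bring (i : ℕ) (hi : i < F.length) (hR : Realizable n H F) :
    Realizable n H (F[i] :: F.eraseIdx i) :=
  hR.mono (List.getElem_cons_eraseIdx_perm hi).subperm

lemma Realizable.tail {T : ℕ × ℕ × ℕ} (hR : Realizable n H (T :: F)) : Realizable n H F :=
  hR.mono (List.sublist_cons_self T F).subperm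

lemma Realizable.swap (hR : Realizable n H ((a, b, c) :: F)) :
    Realizable n H ((b, a, c) :: F) := by
  obtain ⟨P, h, hv, he, hf, hnd⟩ := hR
  have hset : triSet (b, a, c) = triSet (a, b, c) := by
    simp only [triSet]; exact Finset.insert_comm _ _ _
  refine ⟨P, h, hv, he, ?_, ?_⟩
  · rw [List.forall_mem_cons] at hf ⊢
    refine ⟨⟨?_, ?_, ?_⟩, hf.2⟩
    · have := hf.1.1; tauto
    · intro h0
      apply hf.1.2.1
      simp only [cross] at h0 ⊢
      linarith
    · rw [hset]; exact hf.1.2.2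
  · rwa [List.map_cons, hset]

lemma Realizable.rotate (hR : Realizable n H ((a, b, c) :: F)) :
    Realizable n H ((b, c, a) :: F) := by
  obtain ⟨P, h, hv, he, hf, hnd⟩ := hR
  have hset : triSet (b, c, a) = triSet (a, b, c) := by
    ext; simp only [triSet, Finset.mem_insert, Finset.mem_singleton]; tauto
  refine ⟨P, h, hv, he, ?_, ?_⟩
  · rw [List.forall_mem_cons] at hf ⊢
    refine ⟨⟨?_, ?_, ?_⟩, hf.2⟩
    · have := hf.1.1; tauto
    · intro h0
      apply hf.1.2.1
      simp only [cross] at h0 ⊢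
      linarith
    · rw [hset]; exact hf.1.2.2
  · rwa [List.map_cons, hset]

/-- The side of a triangular face is supported on its own. -/
lemma Supported.side {P : ℕ → ℝ × ℝ} {h : ℕ → ℝ} (hs : Supported n P h {a, b, c})
    (hd : cross (P a) (P b) (P c) ≠ 0) (hc : c < n) : Supported n P h {a, b} := by
  obtain ⟨g, hg⟩ := hs
  obtain ⟨m, m1, m2, m3⟩ := exists_affEval_eq hd 0 0 1
  obtain ⟨hab, hac, hbc⟩ := cross_ne hd
  have key : ∀ v ∈ (Finset.range n).filter (fun v => v ∉ ({a, b, c} : Finset ℕ)),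
      ∀ᶠ ε in 𝓝[>] (0 : ℝ), ε * (- affEval m (P v)) < h v - affEval g (P v) := by
    intro v hv
    rw [Finset.mem_filter, Finset.mem_range] at hv
    exact eventually_mul_lt (sub_pos.2 ((hg v hv.1).2 hv.2))
  rw [← Filter.eventually_all_finset] at key
  obtain ⟨ε, hε, hε0⟩ := (key.and self_mem_nhdsWithin).exists
  replace hε0 : 0 < ε := hε0
  refine ⟨(g.1 - ε * m.1, g.2.1 - ε * m.2.1, g.2.2 - ε * m.2.2), fun v hv => ?_⟩
  rw [affEval_sub]
  by_cases hvc : v = c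
  · subst hvc
    have := (hg v hv).1 (by simp)
    refine ⟨fun h => ?_, fun _ => ?_⟩
    · simp only [Finset.mem_insert, Finset.mem_singleton] at h
      omega
    · rw [m3, this]; linarith
  · by_cases hmem : v ∈ ({a, b} : Finset ℕ)
    · refine ⟨fun _ => ?_, fun h => absurd hmem h⟩
      have := (hg v hv).1 (by simp only [Finset.mem_insert, Finset.mem_singleton] at hmem ⊢; tauto)
      simp only [Finset.mem_insert, Finset.mem_singleton] at hmem
      rcases hmem with rfl | rfl
      · rw [this, m1]; ring
      · rw [this, m2]; ring
    · refine ⟨fun h => absurd h hmem, fun _ => ?_⟩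
      have := hε v (by
        simp only [Finset.mem_filter, Finset.mem_range, Finset.mem_insert,
          Finset.mem_singleton] at hmem ⊢
        tauto)
      linarith

/-- A side of the first face can be added as an edge. -/
lemma Realizable.addEdge (hR : Realizable n H ((a, b, c) :: F)) :
    Realizable n (H ⊔ SimpleGraph.edge a b) ((a, b, c) :: F) := by
  obtain ⟨P, h, hv, he, hf, hnd⟩ := hR
  refine ⟨P, h, hv, fun u v huv => ?_, hf, hnd⟩
  obtain ⟨⟨ha, hb, hc⟩, hd, hs⟩ := hf (a, b, c) (by simp)
  rw [SimpleGraph.sup_adj, SimpleGraph.edge_adj] at huv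
  rcases huv with huv | ⟨⟨rfl, rfl⟩ | ⟨rfl, rfl⟩, -⟩
  · exact he u v huv
  · exact ⟨ha, hb, Supported.side hs hd hc⟩
  · refine ⟨hb, ha, ?_⟩
    rw [Finset.pair_comm]
    exact Supported.side hs hd hc

/-- The three edges of a triangle. -/
def triangleGraph (a b c : ℕ) : SimpleGraph ℕ :=
  SimpleGraph.edge a b ⊔ SimpleGraph.edge b c ⊔ SimpleGraph.edge c a

/-- The three edges that join `d` to `a`, `b` and `c`. -/
def starGraph (d a b c : ℕ) : SimpleGraph ℕ :=
  SimpleGraph.edge d a ⊔ SimpleGraph.edge d b ⊔ SimpleGraph.edge d c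

lemma Realizable.addTriangle (hR : Realizable n H ((a, b, c) :: F)) :
    Realizable n (H ⊔ triangleGraph a b c) ((a, b, c) :: F) := by
  simpa only [triangleGraph, ← sup_assoc] using
    hR.addEdge.rotate.addEdge.rotate.addEdge.rotate

/-- Inserting a new vertex into a face and joining it to the three corners. -/
lemma Realizable.addStar (hR : Realizable n H ((a, b, c) :: F)) :
    Realizable (n + 1) (H ⊔ starGraph n a b c) ((n, b, c) :: (a, n, c) :: (a, b, n) :: F) := by
  have h1 := hR.stack.addEdge.rotate.rotate.addEdge.rotate
  have h2 := (h1.mono (List.Perm.swap (n, b, c) (a, n, c) _).subperm).addEdge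
  have h3 := h2.mono (List.Perm.swap (a, n, c) (n, b, c) _).subperm
  rw [SimpleGraph.edge_comm c n, SimpleGraph.edge_comm a n] at h3
  convert h3 using 1
  unfold starGraph
  ac_rfl

end

/-! ### Cycles and distances -/

/-- `G` has a cycle of length `ℓ`, traversed periodically. -/
def HasCycle {V : Type*} (G : SimpleGraph V) (ℓ : ℕ) : Prop :=
  ∃ c : ℕ → V, (∀ k, c (k + ℓ) = c k) ∧ (∀ k, G.Adj (c k) (c (k + 1))) ∧
    ∀ i < ℓ, ∀ j < ℓ, c i = c j → i = j

lemma hasCycle_of_isContained {V : Type*} {G : SimpleGraph V} {ℓ : ℕ} (hℓ : 2 ≤ ℓ)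
    (h : (SimpleGraph.cycleGraph ℓ).IsContained G) : HasCycle G ℓ := by
  obtain ⟨m, rfl⟩ := Nat.exists_eq_add_of_le' hℓ
  obtain ⟨φ⟩ := h
  have hsucc : ∀ k, Fin.ofNat (m + 2) (k + 1) = Fin.ofNat (m + 2) k + 1 := fun k => by
    ext; simp [Fin.val_add, Fin.ofNat]
  refine ⟨fun k => φ (Fin.ofNat (m + 2) k), fun k => ?_, fun k => ?_, fun i hi j hj hij => ?_⟩
  · simp [Fin.ofNat]
  · apply φ.toHom.map_adj
    rw [SimpleGraph.cycleGraph_adj, hsucc]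
    right
    abel
  · have := congrArg Fin.val (φ.injective hij)
    simpa [Fin.ofNat, Nat.mod_eq_of_lt hi, Nat.mod_eq_of_lt hj] using this

lemma HasCycle.map {V W : Type*} {G : SimpleGraph V} {H : SimpleGraph W} {ℓ : ℕ} (f : V → W)
    (hf : Function.Injective f) (hadj : ∀ u v, G.Adj u v → H.Adj (f u) (f v))
    (h : HasCycle G ℓ) : HasCycle H ℓ := by
  obtain ⟨c, h1, h2, h3⟩ := h
  exact ⟨fun k => f (c k), fun k => congrArg f (h1 k), fun k => hadj _ _ (h2 k),
    fun i hi j hj hij => h3 i hi j hj (hf hij)⟩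

/-- `f` changes by at most one along each edge. -/
def IsPotential {V : Type*} (G : SimpleGraph V) (f : V → ℤ) : Prop :=
  ∀ u v, G.Adj u v → f u ≤ f v + 1

/-- A potential shows that the distance of `p` and `q` is at least `d`. -/
def Apart {V : Type*} (G : SimpleGraph V) (d : ℤ) (p q : V) : Prop :=
  ∃ f, IsPotential G f ∧ f p + d ≤ f q

lemma Apart.symm {V : Type*} {G : SimpleGraph V} {d : ℤ} {p q : V} (h : Apart G d p q) :
    Apart G d q p := by
  obtain ⟨f, hf, hpq⟩ := h
  exact ⟨fun v => - f v, fun u v huv => by have := hf v u huv.symm; linarith, by linarith⟩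

lemma Apart.not_adj {V : Type*} {G : SimpleGraph V} {d : ℤ} {p q : V} (h : Apart G d p q)
    (hd : 2 ≤ d) : ¬ G.Adj p q := by
  obtain ⟨f, hf, hpq⟩ := h
  intro hadj
  have := hf q p hadj.symm
  linarith

lemma Apart.ne {V : Type*} {G : SimpleGraph V} {d : ℤ} {p q : V} (h : Apart G d p q)
    (hd : 2 ≤ d) : p ≠ q := by
  obtain ⟨f, hf, hpq⟩ := h
  rintro rfl
  linarith

lemma apart_of_isolated {G : SimpleGraph ℕ} (d : ℤ) {p q : ℕ} (hpq : p ≠ q)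
    (hq : ∀ u, ¬ G.Adj q u) : Apart G d p q := by
  refine ⟨fun v => if v = q then d else 0, fun u v huv => ?_, by simp [hpq]⟩
  have hu : u ≠ q := by rintro rfl; exact hq _ huv
  have hv : v ≠ q := by rintro rfl; exact hq _ huv.symm
  simp [hu, hv]

lemma HasCycle.ne_of_lt {V : Type*} {ℓ : ℕ} {c : ℕ → V} (hper : ∀ k, c (k + ℓ) = c k)
    (hinj : ∀ i < ℓ, ∀ j < ℓ, c i = c j → i = j) {i j : ℕ} (hij : i < j) (hji : j < i + ℓ) :
    c i ≠ c j := by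
  have hℓ : 0 < ℓ := by omega
  intro h
  rw [← (show Function.Periodic c ℓ from hper).map_mod_nat i,
    ← (show Function.Periodic c ℓ from hper).map_mod_nat j] at h
  have h2 : i ≡ j [MOD ℓ] := hinj _ (Nat.mod_lt _ hℓ) _ (Nat.mod_lt _ hℓ) h
  have := Nat.le_of_dvd (by omega) ((Nat.modEq_iff_dvd' hij.le).1 h2)
  omega

/-- Two graphs without `ℓ`-cycles whose common vertices are far apart in one of them have no
`ℓ`-cycle in their union. -/
theorem not_hasCycle_sup {V : Type*} {G₁ G₂ : SimpleGraph V} {ℓ : ℕ} (hℓ : 0 < ℓ)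
    (h₁ : ¬ HasCycle G₁ ℓ) (h₂ : ¬ HasCycle G₂ ℓ) (S : Set V)
    (hS : ∀ u v w, G₁.Adj u v → G₂.Adj u w → u ∈ S)
    (hfar : ∀ p ∈ S, ∀ q ∈ S, p ≠ q → Apart G₁ ℓ p q) : ¬ HasCycle (G₁ ⊔ G₂) ℓ := by
  classical
  rintro ⟨c, hper, hadj, hinj⟩
  have hper' : Function.Periodic c ℓ := hper
  obtain ⟨i, hi⟩ : ∃ i, ¬ G₁.Adj (c i) (c (i + 1)) := by
    by_contra! hcon
    exact h₁ ⟨c, hper, hcon, hinj⟩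
  obtain ⟨j, hj⟩ : ∃ j, ¬ G₂.Adj (c j) (c (j + 1)) := by
    by_contra! hcon
    exact h₂ ⟨c, hper, hcon, hinj⟩
  have hG₂ : ∀ k, ¬ G₁.Adj (c k) (c (k + 1)) → G₂.Adj (c k) (c (k + 1)) := fun k hk =>
    (hadj k).resolve_left hk
  have hmul : ∀ k m, c (k + m * ℓ) = c k := fun k m => by simpa using hper'.nat_mul m k
  have hshift : ∀ k m, G₁.Adj (c (k + m * ℓ)) (c (k + m * ℓ + 1)) ↔ G₁.Adj (c k) (c (k + 1)) := by
    intro k m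
    rw [show k + m * ℓ + 1 = (k + 1) + m * ℓ by ring, hmul, hmul]
  -- By periodicity a `G₁`-edge occurs after the non-`G₁` edge at `i`; the first one starts a
  -- maximal run of `G₁`-edges.
  have hstart : ∃ s, i < s ∧ G₁.Adj (c s) (c (s + 1)) := by
    refine ⟨j + (i + 1) * ℓ, ?_, (hshift _ _).2 ((hadj j).resolve_right hj)⟩
    nlinarith
  obtain ⟨hs1, hs2⟩ := Nat.find_spec hstart
  have hs3 : ∀ m < Nat.find hstart, i < m → ¬ G₁.Adj (c m) (c (m + 1)) := fun m hm h1 h2 =>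
    Nat.find_min hstart hm ⟨h1, h2⟩
  set s := Nat.find hstart
  obtain ⟨t, hts⟩ : ∃ t, s = t + 1 := ⟨s - 1, by omega⟩
  have ht : ¬ G₁.Adj (c t) (c (t + 1)) := by
    rcases Nat.lt_or_ge i t with h | h
    · exact hs3 t (by omega) h
    · obtain rfl : t = i := by omega
      exact hi
  -- The edge at `t = s - 1` is not in `G₁` and recurs at `t + ℓ`, so the run has fewer than `ℓ`
  -- edges and its ends are distinct.
  have hend : ∃ e, s < e ∧ ¬ G₁.Adj (c e) (c (e + 1)) := by
    refine ⟨t + 1 * ℓ, ?_, by rwa [hshift]⟩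
    have hne : t + 1 * ℓ ≠ s := by
      intro h
      rw [← h, hshift] at hs2
      exact ht hs2
    omega
  obtain ⟨he1, he2⟩ := Nat.find_spec hend
  have he3 : ∀ m < Nat.find hend, s < m → G₁.Adj (c m) (c (m + 1)) := fun m hm h1 => by
    by_contra h2
    exact Nat.find_min hend hm ⟨h1, h2⟩
  have he4 : Nat.find hend ≤ t + 1 * ℓ := by
    by_contra hcon
    rcases Nat.lt_or_ge s (t + 1 * ℓ) with h | h
    · exact ht ((hshift t 1).1 (he3 _ (not_le.1 hcon) h))
    · obtain h : s = t + 1 * ℓ := by omega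
      rw [h, hshift] at hs2
      exact ht hs2
  set e := Nat.find hend
  obtain ⟨d, hde⟩ : ∃ d, e = d + 1 := ⟨e - 1, by omega⟩
  have hrun : ∀ m, s ≤ m → m < e → G₁.Adj (c m) (c (m + 1)) := fun m h1 h2 => by
    rcases h1.eq_or_lt with rfl | h
    · exact hs2
    · exact he3 m h2 h
  have hpS : c s ∈ S := by
    refine hS _ _ (c t) hs2 ?_
    have := (hG₂ t ht).symm
    rwa [← hts] at this
  have hqS : c e ∈ S := by
    refine hS _ (c d) _ ?_ (hG₂ e he2)
    have := (hrun d (by omega) (by omega)).symm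
    rwa [← hde] at this
  obtain ⟨f, hf, hfpq⟩ := hfar _ hpS _ hqS (HasCycle.ne_of_lt hper hinj he1 (by omega))
  have hlip : ∀ m, s + m ≤ e → f (c (s + m)) ≤ f (c s) + m := by
    intro m
    induction m with
    | zero => simp
    | succ m ih =>
      intro hm
      have h1 := ih (by omega)
      have h2 := hf _ _ (hrun (s + m) (by omega) (by omega)).symm
      push_cast
      rw [← add_assoc s m 1]
      linarith
  have := hlip (e - s) (by omega)
  rw [show s + (e - s) = e by omega] at this
  have h3 : ((e - s : ℕ) : ℤ) < ℓ := by exact_mod_cast (by omega : e - s < ℓ)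
  linarith

/-- A graph in which all but at most one edge meet a set of `t` vertices has no longer cycles than
`2 * t + 1`. -/
theorem not_hasCycle_of_cover {G : SimpleGraph ℕ} {ℓ : ℕ} (hℓ : 3 ≤ ℓ) (K : Finset ℕ)
    (X : Finset (Sym2 ℕ)) (hcov : ∀ u v, G.Adj u v → u ∈ K ∨ v ∈ K ∨ s(u, v) ∈ X)
    (hcard : 2 * K.card + X.card < ℓ) : ¬ HasCycle G ℓ := by
  rintro ⟨c, hper, hadj, hinj⟩
  have hne : ∀ {i j : ℕ}, i < j → j < i + ℓ → c i ≠ c j := HasCycle.ne_of_lt hper hinj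
  -- Each of the `ℓ` edges of the cycle starts in `K`, ends in `K` or belongs to `X`. The first two
  -- kinds occur at most `K.card` times each, the third at most `X.card` times.
  have h1 : ((Finset.range ℓ).filter fun k => c k ∈ K).card ≤ K.card := by
    refine Finset.card_le_card_of_injOn c (fun k hk => (Finset.mem_filter.1 hk).2) ?_
    intro i hi j hj hij
    simp only [Finset.coe_filter, Set.mem_ofPred_eq, Finset.mem_range] at hi hj
    exact hinj i hi.1 j hj.1 hij
  have h2 : ((Finset.range ℓ).filter fun k => c (k + 1) ∈ K).card ≤ K.card := by
    refine Finset.card_le_card_of_injOn (fun k => c (k + 1))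
      (fun k hk => (Finset.mem_filter.1 hk).2) ?_
    intro i hi j hj hij
    simp only [Finset.coe_filter, Set.mem_ofPred_eq, Finset.mem_range] at hi hj
    by_contra hcon
    rcases Nat.lt_or_gt_of_ne hcon with h | h
    · exact hne (by omega) (by omega) hij
    · exact hne (by omega) (by omega) hij.symm
  have h3 : ((Finset.range ℓ).filter fun k => s(c k, c (k + 1)) ∈ X).card ≤ X.card := by
    refine Finset.card_le_card_of_injOn (fun k => s(c k, c (k + 1)))
      (fun k hk => (Finset.mem_filter.1 hk).2) ?_
    intro i hi j hj hij
    simp only [Finset.coe_filter, Set.mem_ofPred_eq, Finset.mem_range] at hi hj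
    rw [Sym2.eq_iff] at hij
    rcases hij with ⟨h, -⟩ | ⟨ha, hb⟩
    · exact hinj i hi.1 j hj.1 h
    · by_contra hcon
      rcases Nat.lt_or_gt_of_ne hcon with h | h
      · rcases Nat.lt_or_ge (j + 1) (i + ℓ) with h' | h'
        · exact hne (by omega) h' ha
        · obtain ⟨rfl, hj⟩ : i = 0 ∧ j = ℓ - 1 := by omega
          exact hne (by omega) (by omega) hb
      · rcases Nat.lt_or_ge (i + 1) (j + ℓ) with h' | h'
        · exact hne (by omega) h' hb.symm
        · obtain ⟨rfl, hj⟩ : j = 0 ∧ i = ℓ - 1 := by omega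
          exact hne (by omega) (by omega) ha.symm
  have hsub : Finset.range ℓ ⊆ ((Finset.range ℓ).filter fun k => c k ∈ K) ∪
      ((Finset.range ℓ).filter fun k => c (k + 1) ∈ K) ∪
      ((Finset.range ℓ).filter fun k => s(c k, c (k + 1)) ∈ X) := by
    intro k hk
    simp only [Finset.mem_union, Finset.mem_filter]
    have := hcov _ _ (hadj k)
    tauto
  have h4 := Finset.card_le_card hsub
  rw [Finset.card_range] at h4
  have h5 := (Finset.card_union_le _ _).trans' h4
  have h6 := Finset.card_union_le ((Finset.range ℓ).filter fun k => c k ∈ K)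
      ((Finset.range ℓ).filter fun k => c (k + 1) ∈ K)
  omega

/-! ### Blocks -/

lemma starGraph_adj {d a b c u v : ℕ} : (starGraph d a b c).Adj u v ↔
    u ≠ v ∧ ((u = d ∧ (v = a ∨ v = b ∨ v = c)) ∨ (v = d ∧ (u = a ∨ u = b ∨ u = c))) := by
  simp only [starGraph, SimpleGraph.sup_adj, SimpleGraph.edge_adj]
  tauto

lemma triangleGraph_adj {a b c u v : ℕ} : (triangleGraph a b c).Adj u v ↔
    u ≠ v ∧ (u = a ∨ u = b ∨ u = c) ∧ (v = a ∨ v = b ∨ v = c) := by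
  simp only [triangleGraph, SimpleGraph.sup_adj, SimpleGraph.edge_adj]
  constructor
  · rintro ((⟨h, hne⟩ | ⟨h, hne⟩) | ⟨h, hne⟩) <;> exact ⟨hne, by tauto⟩
  · rintro ⟨hne, rfl | rfl | rfl, rfl | rfl | rfl⟩ <;> tauto

lemma edgeSet_finite_of_lt {G : SimpleGraph ℕ} {n : ℕ} (h : ∀ u v, G.Adj u v → u < n) :
    G.edgeSet.Finite := by
  refine (((Set.finite_Iio n).prod (Set.finite_Iio n)).image fun p => s(p.1, p.2)).subset ?_
  intro e
  induction e with | _ u v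
  intro he
  exact ⟨(u, v), ⟨h u v he, h v u (SimpleGraph.Adj.symm he)⟩, rfl⟩

/-- `B` has `e` edges, its vertices lie in `S` or among `k, …, n - 1`, and each of its edges
meets `K` or belongs to `X`. -/
structure IsBlock (S : Finset ℕ) (k n : ℕ) (B : SimpleGraph ℕ) (K : Finset ℕ)
    (X : Finset (Sym2 ℕ)) (e : ℕ) : Prop where
  supp : ∀ u v, B.Adj u v → (u ∈ S ∨ k ≤ u) ∧ u < n
  card : B.edgeSet.ncard = e
  cover : ∀ u v, B.Adj u v → u ∈ K ∨ v ∈ K ∨ s(u, v) ∈ X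

lemma edgeSet_starGraph {d a b c : ℕ} (ha : a ≠ d) (hb : b ≠ d) (hc : c ≠ d) :
    (starGraph d a b c).edgeSet = {s(d, a), s(d, b), s(d, c)} := by
  ext e
  induction e with | _ u v
  simp only [SimpleGraph.mem_edgeSet, starGraph_adj, Set.mem_insert_iff, Set.mem_singleton_iff,
    Sym2.eq_iff]
  constructor
  · tauto
  · rintro (⟨⟨rfl, rfl⟩ | ⟨rfl, rfl⟩⟩ | ⟨⟨rfl, rfl⟩ | ⟨rfl, rfl⟩⟩ | ⟨⟨rfl, rfl⟩ | ⟨rfl, rfl⟩⟩) <;> tauto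

lemma edgeSet_triangleGraph {a b c : ℕ} (hab : a ≠ b) (hac : a ≠ c) (hbc : b ≠ c) :
    (triangleGraph a b c).edgeSet = {s(a, b), s(b, c), s(c, a)} := by
  ext e
  induction e with | _ u v
  simp only [SimpleGraph.mem_edgeSet, triangleGraph_adj, Set.mem_insert_iff,
    Set.mem_singleton_iff, Sym2.eq_iff]
  constructor
  · rintro ⟨hne, rfl | rfl | rfl, rfl | rfl | rfl⟩ <;> tauto
  · rintro (⟨⟨rfl, rfl⟩ | ⟨rfl, rfl⟩⟩ | ⟨⟨rfl, rfl⟩ | ⟨rfl, rfl⟩⟩ | ⟨⟨rfl, rfl⟩ | ⟨rfl, rfl⟩⟩) <;>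
      tauto

lemma ncard_sym2_three {x y z : Sym2 ℕ} (hxy : x ≠ y) (hxz : x ≠ z) (hyz : y ≠ z) :
    ({x, y, z} : Set (Sym2 ℕ)).ncard = 3 :=
  Set.ncard_eq_three.2 ⟨x, y, z, hxy, hxz, hyz, rfl⟩

lemma isBlock_triangle {a b c k n : ℕ} (ha : a < n) (hb : b < n) (hc : c < n) (hab : a ≠ b)
    (hac : a ≠ c) (hbc : b ≠ c) : IsBlock {a, b, c} k n (triangleGraph a b c) {a, b} ∅ 3 where
  supp u v h := by
    rw [triangleGraph_adj] at h
    simp only [Finset.mem_insert, Finset.mem_singleton]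
    omega
  card := by
    rw [edgeSet_triangleGraph hab hac hbc]
    apply ncard_sym2_three <;> rw [Ne, Sym2.eq_iff] <;> tauto
  cover u v h := by
    rw [triangleGraph_adj] at h
    simp only [Finset.mem_insert, Finset.mem_singleton]
    omega

/-- Stacking adds exactly three edges, all at the fresh vertex `n`. They are covered by putting `n`
into the cover, by their old ends, or as exceptional edges. -/
lemma IsBlock.star {S : Finset ℕ} {k n a b c e : ℕ} {B : SimpleGraph ℕ} {K K' : Finset ℕ}
    {X X' : Finset (Sym2 ℕ)} (hB : IsBlock S k n B K X e) (hkn : k ≤ n)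
    (ha : a < n) (hb : b < n) (hc : c < n) (hab : a ≠ b) (hac : a ≠ c) (hbc : b ≠ c)
    (sa : a ∈ S ∨ k ≤ a) (sb : b ∈ S ∨ k ≤ b) (sc : c ∈ S ∨ k ≤ c) (hK : K ⊆ K') (hX : X ⊆ X')
    (ka : n ∈ K' ∨ a ∈ K' ∨ s(n, a) ∈ X') (kb : n ∈ K' ∨ b ∈ K' ∨ s(n, b) ∈ X')
    (kc : n ∈ K' ∨ c ∈ K' ∨ s(n, c) ∈ X') :
    IsBlock S k (n + 1) (B ⊔ starGraph n a b c) K' X' (e + 3) := by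
  refine ⟨fun u v h => ?_, ?_, fun u v h => ?_⟩
  · rw [SimpleGraph.sup_adj, starGraph_adj] at h
    rcases h with h | ⟨-, ⟨rfl, -⟩ | ⟨-, rfl | rfl | rfl⟩⟩
    · have := hB.supp u v h
      exact ⟨this.1, by omega⟩
    · exact ⟨Or.inr hkn, by omega⟩
    · exact ⟨sa, by omega⟩
    · exact ⟨sb, by omega⟩
    · exact ⟨sc, by omega⟩
  · rw [SimpleGraph.edgeSet_sup, Set.ncard_union_eq ?_
      (edgeSet_finite_of_lt fun u v h => (hB.supp u v h).2)
      (edgeSet_finite_of_lt (n := n + 1) fun u v h => by rw [starGraph_adj] at h; omega), hB.card,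
      edgeSet_starGraph ha.ne hb.ne hc.ne, ncard_sym2_three]
    · rw [Ne, Sym2.eq_iff]; omega
    · rw [Ne, Sym2.eq_iff]; omega
    · rw [Ne, Sym2.eq_iff]; omega
    · rw [Set.disjoint_left]
      intro e
      induction e with | _ u v
      intro h1 h2
      rw [SimpleGraph.mem_edgeSet] at h1 h2
      rw [starGraph_adj] at h2
      have h3 := (hB.supp u v h1).2
      have h4 := (hB.supp v u h1.symm).2
      omega
  · rw [SimpleGraph.sup_adj, starGraph_adj] at h
    have hswap : ∀ y, (n ∈ K' ∨ y ∈ K' ∨ s(n, y) ∈ X') → y ∈ K' ∨ n ∈ K' ∨ s(y, n) ∈ X' := by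
      intro y hy
      rw [Sym2.eq_swap]
      rcases hy with h | h | h
      · exact Or.inr (Or.inl h)
      · exact Or.inl h
      · exact Or.inr (Or.inr h)
    rcases h with h | ⟨-, ⟨rfl, rfl | rfl | rfl⟩ | ⟨rfl, rfl | rfl | rfl⟩⟩
    · rcases hB.cover u v h with h | h | h
      · exact Or.inl (hK h)
      · exact Or.inr (Or.inl (hK h))
      · exact Or.inr (Or.inr (hX h))
    exacts [ka, kb, kc, hswap _ ka, hswap _ kb, hswap _ kc]

section
variable {n a b c : ℕ} {H : SimpleGraph ℕ} {F : List (ℕ × ℕ × ℕ)}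

/-- Filling the face `a b k` by a fan of `r` nested triangles whose faces get one vertex each. -/
lemma Realizable.fan {S : Finset ℕ} {k₀ : ℕ} {X : Finset (Sym2 ℕ)} (sa : a ∈ S ∨ k₀ ≤ a)
    (sb : b ∈ S ∨ k₀ ≤ b) (r : ℕ) :
    ∀ {n k e : ℕ} {B : SimpleGraph ℕ} {K : Finset ℕ}, Realizable n (H ⊔ B) ((a, b, k) :: F) →
      IsBlock S k₀ n B K X e → k₀ ≤ n → (k ∈ S ∨ k₀ ≤ k) → a ∈ K → b ∈ K → k ∈ K →
      ∃ (B' : SimpleGraph ℕ) (K' : Finset ℕ),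
        Realizable (n + (3 * r + 1)) (H ⊔ B') F ∧
        IsBlock S k₀ (n + (3 * r + 1)) B' K' X (e + 3 * (3 * r + 1)) ∧ K'.card ≤ K.card + r := by
  induction r with
  | zero =>
    intro n k e B K hR hB hn sk ka kb kk
    obtain ⟨ha, hb, hk⟩ := hR.face_lt (List.mem_cons_self ..)
    obtain ⟨hab, hak, hbk⟩ := hR.face_ne (List.mem_cons_self ..)
    dsimp only at *
    refine ⟨B ⊔ starGraph n a b k, K, ?_, ?_, by omega⟩
    · rw [← sup_assoc]
      exact hR.addStar.tail.tail.tail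
    · exact hB.star hn ha hb hk hab hak hbk sa sb sk subset_rfl subset_rfl (Or.inr (Or.inl ka))
        (Or.inr (Or.inl kb)) (Or.inr (Or.inl kk))
  | succ r ih =>
    intro n k e B K hR hB hn sk ka kb kk
    obtain ⟨ha, hb, hk⟩ := hR.face_lt (List.mem_cons_self ..)
    obtain ⟨hab, hak, hbk⟩ := hR.face_ne (List.mem_cons_self ..)
    dsimp only at ha hb hk hab hak hbk
    -- One round of the fan: `n` joins the cover, and the faces `n b k` and `a n k` each receive a
    -- vertex whose three neighbours are covered. This gives three vertices per cover vertex, and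
    -- the face `a b n` is left for the next round.
    have kn : n ∈ insert n K := Finset.mem_insert_self _ _
    replace ka : a ∈ insert n K := Finset.mem_insert_of_mem ka
    replace kb : b ∈ insert n K := Finset.mem_insert_of_mem kb
    replace kk : k ∈ insert n K := Finset.mem_insert_of_mem kk
    have R1 := hR.addStar.addStar.tail.tail.tail.addStar.tail.tail.tail
    have B1 := hB.star (K' := insert n K) hn ha hb hk hab hak hbk sa sb sk
      (Finset.subset_insert _ _) subset_rfl (Or.inl kn) (Or.inl kn) (Or.inl kn)
    have B2 := B1.star (a := n) (b := b) (c := k) (by omega) (by omega) (by omega) (by omega)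
      (by omega) (by omega) hbk (Or.inr hn) sb sk subset_rfl subset_rfl (Or.inr (Or.inl kn))
      (Or.inr (Or.inl kb)) (Or.inr (Or.inl kk))
    have B3 := B2.star (a := a) (b := n) (c := k) (by omega) (by omega) (by omega) (by omega)
      (by omega) hak (by omega) sa (Or.inr hn) sk subset_rfl subset_rfl (Or.inr (Or.inl ka))
      (Or.inr (Or.inl kn)) (Or.inr (Or.inl kk))
    simp only [sup_assoc] at R1 B3
    obtain ⟨B', K', h1, h2, h3⟩ := ih R1 B3 (by omega) (Or.inr hn) ka kb kn
    refine ⟨B', K', ?_, ?_, ?_⟩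
    · convert h1 using 1; ring
    · convert h2 using 1 <;> ring
    · have := Finset.card_insert_le n K
      omega

/-- A block of order `3 t - 4 + δ` can be drawn in a face. -/
lemma Realizable.exists_block {t δ : ℕ} (ht : 3 ≤ t) (hδ : δ ≤ 1)
    (hR : Realizable n H ((a, b, c) :: F)) : ∃ (B : SimpleGraph ℕ) (K : Finset ℕ)
      (X : Finset (Sym2 ℕ)), Realizable (n + (3 * t + δ - 7)) (H ⊔ B) F ∧
        IsBlock {a, b, c} n (n + (3 * t + δ - 7)) B K X (3 * (3 * t + δ - 6)) ∧ K.card ≤ t ∧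
        X.card ≤ δ := by
  obtain ⟨ha, hb, hc⟩ := hR.face_lt (List.mem_cons_self ..)
  obtain ⟨hab, hac, hbc⟩ := hR.face_ne (List.mem_cons_self ..)
  dsimp only at ha hb hc hab hac hbc
  have sa : a ∈ ({a, b, c} : Finset ℕ) ∨ n ≤ a := by simp
  have sb : b ∈ ({a, b, c} : Finset ℕ) ∨ n ≤ b := by simp
  have sc : c ∈ ({a, b, c} : Finset ℕ) ∨ n ≤ c := by simp
  have ka : a ∈ ({n, a, b} : Finset ℕ) := by simp
  have kb : b ∈ ({n, a, b} : Finset ℕ) := by simp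
  have kn : n ∈ ({n, a, b} : Finset ℕ) := by simp
  have R1 := hR.addTriangle.addStar
  have B1 := (isBlock_triangle (k := n) ha hb hc hab hac hbc).star (K' := {n, a, b}) le_rfl
    ha hb hc hab hac hbc sa sb sc (Finset.subset_insert _ _) subset_rfl (Or.inl kn) (Or.inl kn)
    (Or.inl kn)
  have hKcard : ({n, a, b} : Finset ℕ).card ≤ 3 := Finset.card_le_three
  rw [sup_assoc] at R1
  -- For `δ = 1` an extra vertex goes into the face `a n c`. Since `c` is not in the cover, its edge
  -- to `c` is the single exceptional edge.
  have hfan : ∃ (n' e' : ℕ) (B' : SimpleGraph ℕ) (X : Finset (Sym2 ℕ)), n' = n + 1 + δ ∧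
      e' = 6 + 3 * δ ∧ X.card ≤ δ ∧ Realizable n' (H ⊔ B') ((a, b, n) :: F) ∧
      IsBlock {a, b, c} n n' B' {n, a, b} X e' := by
    interval_cases δ
    · exact ⟨_, _, _, _, rfl, rfl, by simp, R1.tail.tail, B1⟩
    · have R2 := R1.tail.addStar.tail.tail.tail
      rw [sup_assoc] at R2
      refine ⟨_, _, _, {s(n + 1, c)}, rfl, rfl, by simp, R2, ?_⟩
      exact B1.star (by omega) (by omega) (by omega) (by omega) (by omega) hac (by omega) sa
        (Or.inr le_rfl) sc subset_rfl (Finset.empty_subset _) (Or.inr (Or.inl ka))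
        (Or.inr (Or.inl kn)) (Or.inr (Or.inr (by simp)))
  obtain ⟨n', e', B', X, rfl, rfl, hX, R2, B2⟩ := hfan
  -- The cover already contains `n`, `a` and `b`, so `t - 3` rounds remain.
  obtain ⟨B'', K'', R3, B3, hK⟩ := R2.fan sa sb (t - 3) B2 (by omega) (Or.inr le_rfl) ka kb kn
  refine ⟨B'', K'', X, ?_, ?_, by omega, hX⟩
  · convert R3 using 1; omega
  · convert B3 using 1 <;> omega

end

/-! ### Gluing blocks -/

/-- A partial construction without `ℓ`-cycles: a drawing of the graph `H` on `0, …, n - 1` with `m`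
edges and empty triangular faces `F`. -/
structure IsState (ℓ n m : ℕ) (H : SimpleGraph ℕ) (F : List (ℕ × ℕ × ℕ)) : Prop where
  real : Realizable n H F
  card : H.edgeSet.ncard = m
  noCycle : ¬ HasCycle H ℓ

/-- Blocks have `q + 3 = 3 t - 4 + δ` vertices, and their cycles are shorter than `ℓ`. -/
structure IsBlockSize (ℓ t δ q : ℕ) : Prop where
  three_le : 3 ≤ t
  le_one : δ ≤ 1
  length : ℓ = 2 * t + 1 + δ
  order : q + 7 = 3 * t + δ

/-- The vertex `v` has no neighbours in `G`. -/
def Isolated (G : SimpleGraph ℕ) (v : ℕ) : Prop := ∀ u, ¬ G.Adj v u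

/-- Numbers from `n` on carry no edges yet, so a potential may be given any prescribed values at
vertices that are still to be placed. -/
lemma IsPotential.congr {n : ℕ} {H : SimpleGraph ℕ} {F : List (ℕ × ℕ × ℕ)} {f g : ℕ → ℤ}
    (hR : Realizable n H F) (hf : IsPotential H f) (hfg : ∀ v < n, g v = f v) :
    IsPotential H g := by
  intro u v huv
  obtain ⟨hu, hv⟩ := hR.lt huv
  rw [hfg u hu, hfg v hv]
  exact hf u v huv

lemma Realizable.isolated {n v : ℕ} {H : SimpleGraph ℕ} {F : List (ℕ × ℕ × ℕ)}
    (hR : Realizable n H F) (hv : n ≤ v) : Isolated H v := fun u hu => by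
  have := (hR.lt hu).1
  omega

/-- A block can be placed in a face whose corners are far apart. -/
lemma IsState.addBlock {ℓ t δ q n m a b c : ℕ} {H : SimpleGraph ℕ} {F : List (ℕ × ℕ × ℕ)}
    (hp : IsBlockSize ℓ t δ q) (hs : IsState ℓ n m H ((a, b, c) :: F)) (hab : Apart H ℓ a b)
    (hac : Apart H ℓ a c) (hbc : Apart H ℓ b c) : ∃ H' : SimpleGraph ℕ,
      IsState ℓ (n + q) (m + 3 * (q + 1)) H' F ∧
      (∀ v < n, v ≠ a → v ≠ b → v ≠ c → Isolated H v → Isolated H' v) ∧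
      ∀ f, IsPotential H f → (f a ≤ f b + 1 ∧ f b ≤ f a + 1 ∧ f a ≤ f c + 1 ∧ f c ≤ f a + 1 ∧
        f b ≤ f c + 1 ∧ f c ≤ f b + 1) → ∃ f', IsPotential H' f' ∧ ∀ v < n, f' v = f v := by
  obtain ⟨ht, hδ, hℓ, hq⟩ := hp
  obtain ⟨B, K, X, hR, hB, hK, hX⟩ := hs.real.exists_block ht hδ
  rw [show 3 * t + δ - 7 = q by omega] at hR hB
  rw [show 3 * t + δ - 6 = q + 1 by omega] at hB
  have hℓ2 : (2 : ℤ) ≤ ℓ := by omega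
  have hlt : ∀ {u v}, H.Adj u v → u < n ∧ v < n := fun h => hs.real.lt h
  have hmem : ∀ {u v}, B.Adj u v → u < n → u ∈ ({a, b, c} : Finset ℕ) := fun h hu =>
    (hB.supp _ _ h).1.resolve_right (by omega)
  have hfar : ∀ p ∈ ({a, b, c} : Finset ℕ), ∀ q ∈ ({a, b, c} : Finset ℕ), p ≠ q →
      Apart H ℓ p q := by
    simp only [Finset.mem_insert, Finset.mem_singleton]
    rintro p (rfl | rfl | rfl) q (rfl | rfl | rfl) hpq
    exacts [absurd rfl hpq, hab, hac, hab.symm, absurd rfl hpq, hbc, hac.symm, hbc.symm,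
      absurd rfl hpq]
  refine ⟨H ⊔ B, ⟨hR, ?_, ?_⟩, ?_, ?_⟩
  · rw [SimpleGraph.edgeSet_sup, Set.ncard_union_eq ?_
      (edgeSet_finite_of_lt fun u v h => (hlt h).1)
      (edgeSet_finite_of_lt fun u v h => (hB.supp u v h).2), hs.card, hB.card]
    rw [Set.disjoint_left]
    intro e
    induction e with | _ u v
    intro h1 h2
    rw [SimpleGraph.mem_edgeSet] at h1 h2
    obtain ⟨hu, hv⟩ := hlt h1
    exact (hfar u (hmem h2 hu) v (hmem h2.symm hv) h1.ne).not_adj hℓ2 h1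
  · refine not_hasCycle_sup (by omega) hs.noCycle
      (not_hasCycle_of_cover (by omega) K X hB.cover (by omega)) (({a, b, c} : Finset ℕ) : Set ℕ)
      (fun u v w h1 h2 => hmem h2 (hlt h1).1) hfar
  · intro v hv h1 h2 h3 hiso u huv
    rcases huv with huv | huv
    · exact hiso u huv
    · have := hmem huv hv
      simp only [Finset.mem_insert, Finset.mem_singleton] at this
      tauto
  · intro f hf hfc
    -- All interior vertices of the block get the value of the corner `a`, which is within 1 of each
    -- corner.
    refine ⟨fun v => if v < n then f v else f a, ?_, fun v hv => by simp [hv]⟩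
    rintro u v (huv | huv)
    · obtain ⟨hu, hv⟩ := hlt huv
      simp only [hu, hv, if_true]
      exact hf u v huv
    · dsimp only
      split_ifs with h1 h2 h2
      · have k1 := hmem huv h1
        have k2 := hmem huv.symm h2
        simp only [Finset.mem_insert, Finset.mem_singleton] at k1 k2
        rcases k1 with rfl | rfl | rfl <;> rcases k2 with rfl | rfl | rfl <;> omega
      · have k1 := hmem huv h1
        simp only [Finset.mem_insert, Finset.mem_singleton] at k1
        rcases k1 with rfl | rfl | rfl <;> omega
      · have k2 := hmem huv.symm h2
        simp only [Finset.mem_insert, Finset.mem_singleton] at k2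
        rcases k2 with rfl | rfl | rfl <;> omega
      · omega

lemma IsState.bring {ℓ n m : ℕ} {H : SimpleGraph ℕ} {F : List (ℕ × ℕ × ℕ)} (i : ℕ)
    (hi : i < F.length) (hs : IsState ℓ n m H F) : IsState ℓ n m H (F[i] :: F.eraseIdx i) :=
  ⟨hs.real.bring i hi, hs.card, hs.noCycle⟩

lemma IsState.rotate {ℓ n m a b c : ℕ} {H : SimpleGraph ℕ} {F : List (ℕ × ℕ × ℕ)}
    (hs : IsState ℓ n m H ((a, b, c) :: F)) : IsState ℓ n m H ((b, c, a) :: F) :=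
  ⟨hs.real.rotate, hs.card, hs.noCycle⟩

/-- A chain of `k + 1` blocks can be placed along the side `s e` of a face. -/
lemma IsState.addChain {ℓ t δ q e w : ℕ} (hp : IsBlockSize ℓ t δ q) (k : ℕ) :
    ∀ {n m s : ℕ} {H : SimpleGraph ℕ} {F : List (ℕ × ℕ × ℕ)},
    IsState ℓ n m H ((s, e, w) :: F) → Apart H ℓ s e → ∃ H' : SimpleGraph ℕ,
      IsState ℓ (n + (k * (q + 2) + q + 1)) (m + (k + 1) * (3 * (q + 1))) H' F ∧
      (∀ v < n, v ≠ s → v ≠ e → Isolated H v → Isolated H' v) ∧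
      ∀ f, IsPotential H f → (f s ≤ f e + (k + 1) ∧ f e ≤ f s + (k + 1)) →
        ∃ f', IsPotential H' f' ∧ ∀ v < n, f' v = f v := by
  induction k with
  | zero =>
    intro n m s H F hs hse
    obtain ⟨hsn, hen, hwn⟩ := hs.real.face_lt (List.mem_cons_self ..)
    dsimp only at hsn hen hwn
    have hR : Realizable (n + 1) H ((s, e, n) :: F) := (hs.real.stack.bring 2 (by simp)).mono (by
      simp only [List.getElem_cons_succ, List.getElem_cons_zero, List.eraseIdx_cons_succ,
        List.eraseIdx_cons_zero]
      exact (List.Sublist.cons_cons _ (.cons _ (.cons _ (List.Sublist.refl _)))).subperm)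
    have hiso := hs.real.isolated (le_refl n)
    obtain ⟨H', h1, h2, h3⟩ := IsState.addBlock hp ⟨hR, hs.card, hs.noCycle⟩ hse
      (apart_of_isolated _ hsn.ne hiso) (apart_of_isolated _ hen.ne hiso)
    refine ⟨H', ?_, fun v hv hvs hve => h2 v (by omega) hvs hve (by omega), fun f hf hfc => ?_⟩
    · convert h1 using 1 <;> ring
    · have hpot := hf.congr (g := fun v => if v = n then f s else f v) hs.real
        (fun v hv => by simp [hv.ne])
      obtain ⟨f', hf', hff⟩ := h3 _ hpot (by
        simp only [hsn.ne, hen.ne, if_true, if_false]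
        push_cast at hfc
        omega)
      exact ⟨f', hf', fun v hv => by rw [hff v (by omega)]; simp [hv.ne]⟩
  | succ k ih =>
    intro n m s H F hs hse
    obtain ⟨hsn, hen, hwn⟩ := hs.real.face_lt (List.mem_cons_self ..)
    dsimp only at hsn hen hwn
    -- The vertex `n` is the next joint of the chain and `n + 1` the free third corner of the block;
    -- the rest of the chain goes along `n e`.
    have hR : Realizable (n + 1 + 1) H ((s, n, n + 1) :: (n, e, w) :: F) :=
      ((hs.real.stack.bring 1 (by simp)).stack.bring 2 (by simp)).mono (by
        simp only [List.getElem_cons_succ, List.getElem_cons_zero, List.eraseIdx_cons_succ,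
          List.eraseIdx_cons_zero]
        exact (List.Sublist.cons_cons _ (.cons _ (.cons _ (List.Sublist.cons_cons _
          (.cons _ (List.Sublist.refl _)))))).subperm)
    have hiso := hs.real.isolated (le_refl n)
    have hiso' := hs.real.isolated (Nat.le_succ n)
    obtain ⟨H₁, h1, h2, h3⟩ := IsState.addBlock hp ⟨hR, hs.card, hs.noCycle⟩
      (apart_of_isolated _ hsn.ne hiso) (apart_of_isolated _ (by omega) hiso')
      (apart_of_isolated _ (by omega) hiso')
    have hext : ∀ f, IsPotential H f → ∀ x : ℤ, f s ≤ x + 1 → x ≤ f s + 1 →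
        ∃ f', IsPotential H₁ f' ∧ f' n = x ∧ ∀ v < n, f' v = f v := by
      intro f hf x hx1 hx2
      have hpot := hf.congr (g := fun v => if v = n then x else if v = n + 1 then x else f v)
        hs.real (fun v hv => by
          rw [if_neg (by omega), if_neg (by omega)])
      obtain ⟨f', hf', hff⟩ := h3 _ hpot (by
        rw [if_neg (by omega), if_neg (by omega), if_pos rfl, if_neg (by omega), if_pos rfl]
        omega)
      refine ⟨f', hf', ?_, fun v hv => ?_⟩
      · rw [hff n (by omega), if_pos rfl]
      · rw [hff v (by omega), if_neg (by omega), if_neg (by omega)]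
    -- Giving `n` the value of `s` shows that the joint is as far from `e` as `s` was guaranteed to
    -- be.
    have hne : Apart H₁ ℓ n e := by
      obtain ⟨f, hf, hfse⟩ := hse
      obtain ⟨f', hf', hfn, hff⟩ := hext f hf (f s) (by omega) (by omega)
      exact ⟨f', hf', by rw [hfn, hff e hen]; exact hfse⟩
    obtain ⟨H₂, g1, g2, g3⟩ := ih h1 hne
    refine ⟨H₂, ?_, fun v hv hvs hve hvi => ?_, fun f hf hfc => ?_⟩
    · convert g1 using 1 <;> ring
    · exact g2 v (by omega) (by omega) hve (h2 v (by omega) hvs (by omega) (by omega) hvi)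
    · push_cast at hfc
      -- The joint takes the value one step from `f s` towards `f e`.
      obtain ⟨x, hx⟩ : ∃ x : ℤ, f s ≤ x + 1 ∧ x ≤ f s + 1 ∧ x ≤ f e + (k + 1) ∧
          f e ≤ x + (k + 1) := by
        rcases lt_trichotomy (f s) (f e) with h | h | h
        · exact ⟨f s + 1, by omega⟩
        · exact ⟨f s, by omega⟩
        · exact ⟨f s - 1, by omega⟩
      obtain ⟨f', hf', hfn, hff⟩ := hext f hf x hx.1 hx.2.1
      obtain ⟨f'', hf'', hff'⟩ := g3 f' hf' (by rw [hfn, hff e hen]; exact ⟨hx.2.2.1, hx.2.2.2⟩)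
      exact ⟨f'', hf'', fun v hv => by rw [hff' v (by omega), hff v hv]⟩

/-! ### Layers -/

section
variable {n x y z : ℕ} {H : SimpleGraph ℕ}

/-- The skeleton of a layer in a triangle. -/
lemma Realizable.skeleton (hR : Realizable n H [(x, y, z)]) : Realizable (n + 10) H
    [(n, n + 8, n + 9), (n + 4, n + 7, n + 9), (n + 2, n + 7, n + 8), (n + 7, n + 8, n + 9),
      (n + 9, n, n + 4), (n + 8, n, n + 2), (n + 7, n + 4, n + 2), (n + 6, n + 5, n + 4),
      (z, n + 6, n + 4), (z, n + 5, n + 6), (n + 5, n + 3, n + 4), (z, n + 3, n + 5),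
      (n + 1, n + 2, n + 3), (n + 2, n + 3, n + 4), (n + 4, z, n), (n + 3, z, n + 1),
      (n + 2, n, n + 1), (n + 1, y, z), (n, y, n + 1), (x, n, z), (x, y, n)] :=
  (((hR.stack.stack.bring 1 (by simp)).rotate.rotate.octa.stack.bring 1
    (by simp)).stack.bring 5 (by simp)).rotate.swap.rotate.rotate.octa

/-- Adding a layer, up to its last block. -/
lemma IsState.addOpenLayer {ℓ t δ q m i j k : ℕ} (hp : IsBlockSize ℓ t δ q)
    (hs : IsState ℓ n m H [(x, y, z)]) : ∃ H' : SimpleGraph ℕ,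
      IsState ℓ (n + (2 * i + j + k + 8) * (q + 2))
        (m + (2 * i + j + k + 8) * (3 * (q + 1))) H'
        [(z, n + 5, n + 6), (n + 2, n + 7, n + 8)] ∧
      ∀ f, IsPotential H f →
        (f x ≤ f n + (i + 1) ∧ f n ≤ f x + (i + 1)) →
        (f (n + 1) ≤ f y + (k + 1) ∧ f y ≤ f (n + 1) + (k + 1)) →
        (f (n + 1) ≤ f (n + 2) + 1 ∧ f (n + 2) ≤ f (n + 1) + 1 ∧ f (n + 1) ≤ f (n + 3) + 1 ∧
          f (n + 3) ≤ f (n + 1) + 1 ∧ f (n + 2) ≤ f (n + 3) + 1 ∧ f (n + 3) ≤ f (n + 2) + 1) →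
        (f (n + 5) ≤ f (n + 3) + (i + 2) ∧ f (n + 3) ≤ f (n + 5) + (i + 2)) →
        (f n ≤ f (n + 8) + 1 ∧ f (n + 8) ≤ f n + 1 ∧ f n ≤ f (n + 9) + 1 ∧
          f (n + 9) ≤ f n + 1 ∧ f (n + 8) ≤ f (n + 9) + 1 ∧ f (n + 9) ≤ f (n + 8) + 1) →
        (f (n + 4) ≤ f (n + 7) + 1 ∧ f (n + 7) ≤ f (n + 4) + 1 ∧ f (n + 4) ≤ f (n + 9) + 1 ∧
          f (n + 9) ≤ f (n + 4) + 1 ∧ f (n + 7) ≤ f (n + 9) + 1 ∧ f (n + 9) ≤ f (n + 7) + 1) →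
        (f (n + 4) ≤ f (n + 6) + (j + 1) ∧ f (n + 6) ≤ f (n + 4) + (j + 1)) →
        ∃ f', IsPotential H' f' ∧ ∀ v < n + 10, f' v = f v := by
  obtain ⟨hx, hy, hz⟩ := hs.real.face_lt (List.mem_cons_self ..)
  dsimp only at hx hy hz
  have hI : ∀ v, n ≤ v → Isolated H v := fun v hv => hs.real.isolated hv
  -- Until the last block, every block or chain is attached at isolated vertices, so the required
  -- distances are automatic. The last block, on `z`, `n + 5`, `n + 6`, is left out because it
  -- closes cycles.
  have s₀ : IsState ℓ (n + 10) m H _ := ⟨hs.real.skeleton, hs.card, hs.noCycle⟩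
  obtain ⟨H₁, s₁, i₁, e₁⟩ := (s₀.bring 19 (by simp)).addChain hp i
    (apart_of_isolated _ hx.ne (hI _ le_rfl))
  obtain ⟨H₂, s₂, i₂, e₂⟩ := (s₁.bring 17 (by simp)).addChain hp k
    (apart_of_isolated _ (by omega : y ≠ n + 1)
      (i₁ _ (by omega) (by omega) (by omega) (hI _ (by omega)))).symm
  have hI₂ : ∀ v, n + 1 < v → v < n + 10 → Isolated H₂ v := fun v h1 h2 =>
    i₂ v (by omega) (by omega) (by omega) (i₁ v h2 (by omega) (by omega) (hI v (by omega)))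
  obtain ⟨H₃, s₃, i₃, e₃⟩ := (s₂.bring 12 (by simp)).addBlock hp
    (apart_of_isolated _ (by omega) (hI₂ (n + 2) (by omega) (by omega)))
    (apart_of_isolated _ (by omega) (hI₂ (n + 3) (by omega) (by omega)))
    (apart_of_isolated _ (by omega) (hI₂ (n + 3) (by omega) (by omega)))
  have hI₃ : ∀ v, n + 3 < v → v < n + 10 → Isolated H₃ v := fun v h1 h2 =>
    i₃ v (by omega) (by omega) (by omega) (by omega) (hI₂ v (by omega) (by omega))
  obtain ⟨H₄, s₄, i₄, e₄⟩ := (s₃.bring 10 (by simp)).addChain hp (i + 1)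
    (apart_of_isolated _ (by omega) (hI₃ (n + 5) (by omega) (by omega))).symm
  have hI₄ : ∀ v, v = n + 4 ∨ n + 5 < v → v < n + 10 → Isolated H₄ v :=
    fun v h1 h2 => i₄ v (by omega) (by omega) (by omega) (hI₃ v (by omega) (by omega))
  obtain ⟨H₅, s₅, i₅, e₅⟩ := s₄.addBlock hp
    (apart_of_isolated _ (by omega) (hI₄ (n + 8) (by omega) (by omega)))
    (apart_of_isolated _ (by omega) (hI₄ (n + 9) (by omega) (by omega)))
    (apart_of_isolated _ (by omega) (hI₄ (n + 9) (by omega) (by omega)))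
  have hI₅ : ∀ v, v = n + 4 ∨ v = n + 6 ∨ v = n + 7 → Isolated H₅ v := fun v h1 =>
    i₅ v (by omega) (by omega) (by omega) (by omega) (hI₄ v (by omega) (by omega))
  obtain ⟨H₆, s₆, i₆, e₆⟩ := s₅.addBlock hp
    (apart_of_isolated _ (by omega) (hI₅ (n + 7) (by omega)))
    (apart_of_isolated _ (by omega) (hI₅ (n + 4) (by omega))).symm
    (apart_of_isolated _ (by omega) (hI₅ (n + 7) (by omega))).symm
  obtain ⟨H₇, s₇, i₇, e₇⟩ := (s₆.bring 5 (by simp)).rotate.rotate.addChain hp j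
    (apart_of_isolated _ (by omega)
      (i₆ (n + 6) (by omega) (by omega) (by omega) (by omega) (hI₅ (n + 6) (by omega))))
  refine ⟨H₇, ⟨?_, ?_, s₇.noCycle⟩, ?_⟩
  · have R := (s₇.real.bring 6 (by simp)).mono (F' := [(z, n + 5, n + 6), (n + 2, n + 7, n + 8)])
      (((List.nil_sublist _).cons_cons _).cons_cons _).subperm
    convert R using 1
    ring
  · rw [s₇.card]; ring
  · intro f hf c₁ c₂ c₃ c₄ c₅ c₆ c₇
    obtain ⟨f₁, p₁, g₁⟩ := e₁ f hf c₁
    obtain ⟨f₂, p₂, g₂⟩ := e₂ f₁ p₁ (by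
      rw [g₁ _ (by omega), g₁ _ (by omega)]; exact c₂)
    replace g₂ : ∀ v < n + 10, f₂ v = f v := fun v hv => by rw [g₂ v (by omega), g₁ v hv]
    obtain ⟨f₃, p₃, g₃⟩ := e₃ f₂ p₂ (by
      rw [g₂ _ (by omega), g₂ _ (by omega), g₂ _ (by omega)]; exact c₃)
    replace g₃ : ∀ v < n + 10, f₃ v = f v := fun v hv => by rw [g₃ v (by omega), g₂ v hv]
    obtain ⟨f₄, p₄, g₄⟩ := e₄ f₃ p₃ (by
      rw [g₃ _ (by omega), g₃ _ (by omega)]; push_cast; omega)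
    replace g₄ : ∀ v < n + 10, f₄ v = f v := fun v hv => by rw [g₄ v (by omega), g₃ v hv]
    obtain ⟨f₅, p₅, g₅⟩ := e₅ f₄ p₄ (by
      rw [g₄ _ (by omega), g₄ _ (by omega), g₄ _ (by omega)]; exact c₅)
    replace g₅ : ∀ v < n + 10, f₅ v = f v := fun v hv => by rw [g₅ v (by omega), g₄ v hv]
    obtain ⟨f₆, p₆, g₆⟩ := e₆ f₅ p₅ (by
      rw [g₅ _ (by omega), g₅ _ (by omega), g₅ _ (by omega)]; exact c₆)
    replace g₆ : ∀ v < n + 10, f₆ v = f v := fun v hv => by rw [g₆ v (by omega), g₅ v hv]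
    obtain ⟨f₇, p₇, g₇⟩ := e₇ f₆ p₆ (by
      rw [g₆ _ (by omega), g₆ _ (by omega)]; exact c₇)
    exact ⟨f₇, p₇, fun v hv => by rw [g₇ v (by omega), g₆ v hv]⟩

end

/-- The state between two layers: an empty triangle whose corners are far apart. -/
structure IsLayer (ℓ n m B C : ℕ) (H : SimpleGraph ℕ) (x y z : ℕ) : Prop where
  state : IsState ℓ n m H [(x, y, z)]
  apart_fst : Apart H (C + 1) x z
  apart_snd : Apart H (B + 1) y z
  apart_trd : Apart H 2 x y

/-- As the corners are pairwise nonadjacent, each may deviate by 1 from a common value `M` of all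
other vertices. The old graph is thus treated as a star with leaves `x, y, z`. -/
lemma isPotential_three {H : SimpleGraph ℕ} {x y z : ℕ} (hxy : ¬ H.Adj x y) (hxz : ¬ H.Adj x z)
    (hyz : ¬ H.Adj y z) {X Y Z M : ℤ} (hX : X ≤ M + 1 ∧ M ≤ X + 1) (hY : Y ≤ M + 1 ∧ M ≤ Y + 1)
    (hZ : Z ≤ M + 1 ∧ M ≤ Z + 1) :
    IsPotential H fun v => if v = x then X else if v = y then Y else if v = z then Z else M := by
  intro u v huv
  have h1 : ¬ H.Adj y x := fun h => hxy h.symm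
  have h2 : ¬ H.Adj z x := fun h => hxz h.symm
  have h3 : ¬ H.Adj z y := fun h => hyz h.symm
  dsimp only
  split_ifs <;> subst_vars <;> first | omega | contradiction

/-- Adding a layer that closes an old triangle and opens a new one. -/
lemma IsLayer.next {ℓ t δ q n m i j k x y z : ℕ} {H : SimpleGraph ℕ} (hp : IsBlockSize ℓ t δ q)
    (hℓ : ℓ = 2 * i + j + k + 10) (hij : i ≤ j) (hji : j ≤ i + 1) (hjk : j ≤ k) (hkj : k ≤ j + 1)
    (h : IsLayer ℓ n m (i + j + 5) (i + k + 5) H x y z) : ∃ H' : SimpleGraph ℕ,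
      IsLayer ℓ (n + ((ℓ - 2) * (q + 2) + q)) (m + (ℓ - 1) * (3 * (q + 1))) (i + j + 5) (i + k + 5)
        H' (n + 8) (n + 7) (n + 2) := by
  obtain ⟨hs, hxz, hyz, hxy⟩ := h
  push_cast at hxz hyz
  obtain ⟨hx, hy, hz⟩ := hs.real.face_lt (List.mem_cons_self ..)
  obtain ⟨nxy, nxz, nyz⟩ := hs.real.face_ne (List.mem_cons_self ..)
  dsimp only at hx hy hz nxy nxz nyz
  have axy := hxy.not_adj le_rfl
  have axz := hxz.not_adj (by omega)
  have ayz := hyz.not_adj (by omega)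
  obtain ⟨H₁, s₁, e₁⟩ := hs.addOpenLayer (i := i) (j := j) (k := k) hp
  -- The letters `a v w u c r p y' x' b` are the values at `n, …, n + 9`. The chains `x a`, `v y`,
  -- `u r`, `c p` have `i + 1`, `k + 1`, `i + 2`, `j + 1` blocks; single blocks sit on `v w u`, `a
  -- x' b`, `c y' b`. The new triangle is `x' y' w`.
  have ext₁ : ∀ g, IsPotential H g → ∀ a v w u c r p y' x' b : ℤ,
      ((g x ≤ a + (i + 1) ∧ a ≤ g x + (i + 1)) ∧ (v ≤ g y + (k + 1) ∧ g y ≤ v + (k + 1)) ∧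
        (v ≤ w + 1 ∧ w ≤ v + 1 ∧ v ≤ u + 1 ∧ u ≤ v + 1 ∧ w ≤ u + 1 ∧ u ≤ w + 1) ∧
        (r ≤ u + (i + 2) ∧ u ≤ r + (i + 2)) ∧
        (a ≤ x' + 1 ∧ x' ≤ a + 1 ∧ a ≤ b + 1 ∧ b ≤ a + 1 ∧ x' ≤ b + 1 ∧ b ≤ x' + 1) ∧
        (c ≤ y' + 1 ∧ y' ≤ c + 1 ∧ c ≤ b + 1 ∧ b ≤ c + 1 ∧ y' ≤ b + 1 ∧ b ≤ y' + 1) ∧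
        (c ≤ p + (j + 1) ∧ p ≤ c + (j + 1))) →
      ∃ f, IsPotential H₁ f ∧ (∀ v < n, f v = g v) ∧ f (n + 2) = w ∧ f (n + 5) = r ∧
        f (n + 6) = p ∧ f (n + 7) = y' ∧ f (n + 8) = x' := by
    intro g hg a v w u c r p y' x' b hc
    obtain ⟨f, hf, hfv⟩ := e₁
      (fun s => if s < n then g s else ([a, v, w, u, c, r, p, y', x', b] : List ℤ).getD (s - n) 0)
      (hg.congr hs.real fun s hs => by simp [hs]) (by simpa [hx] using hc.1)
      (by simpa [hy] using hc.2.1) (by simpa using hc.2.2.1) (by simpa using hc.2.2.2.1)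
      (by simpa using hc.2.2.2.2.1) (by simpa using hc.2.2.2.2.2.1)
      (by simpa using hc.2.2.2.2.2.2)
    refine ⟨f, hf, fun s hs => ?_, ?_, ?_, ?_, ?_, ?_⟩
    · rw [hfv s (by omega)]; simp [hs]
    all_goals rw [hfv _ (by omega)]; simp
  -- The distance from `p` to `x` is `i + j + 4` and from `r` to `y` it is `i + k + 4` along the
  -- layer. Together with 2 from `x` to `y` the sum is exactly `ℓ`; the bounds for `x z` and `y z`
  -- are chosen so that the next two sums are also exactly `ℓ`.
  have hqp : Apart H₁ ℓ (n + 5) (n + 6) := by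
    obtain ⟨g, hg, hgxy⟩ := hxy
    obtain ⟨f, hf, -, -, h5, h6, -⟩ := ext₁ g hg (g x - (i + 1)) (g y + (k + 1)) (g y + (k + 1))
      (g y + (k + 2)) (g x - (i + 3)) (g y + (i + k + 4)) (g x - (i + j + 4)) (g x - (i + 2))
      (g x - (i + 1)) (g x - (i + 2)) (by omega)
    exact Apart.symm ⟨f, hf, by rw [h5, h6]; omega⟩
  have hzp : Apart H₁ ℓ z (n + 6) := by
    obtain ⟨g, hg, hgxz⟩ := hxz
    obtain ⟨f, hf, hfv, -, -, h6, -⟩ := ext₁ g hg (g x - (i + 1)) (g y) (g y)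
      (g y) (g x - (i + 3)) (g y) (g x - (i + j + 4)) (g x - (i + 2))
      (g x - (i + 1)) (g x - (i + 2)) (by omega)
    exact Apart.symm ⟨f, hf, by rw [hfv z hz, h6]; omega⟩
  have hzq : Apart H₁ ℓ z (n + 5) := by
    obtain ⟨g, hg, hgyz⟩ := hyz
    obtain ⟨f, hf, hfv, -, h5, -⟩ := ext₁ g hg (g x) (g y - (k + 1)) (g y - (k + 1))
      (g y - (k + 2)) (g x) (g y - (i + k + 4)) (g x) (g x) (g x) (g x) (by omega)
    exact Apart.symm ⟨f, hf, by rw [hfv z hz, h5]; omega⟩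
  obtain ⟨H₂, s₂, -, e₂⟩ := s₁.addBlock hp hzq hzp hqp
  have hN : n + 10 ≤ n + (2 * i + j + k + 8) * (q + 2) := by nlinarith
  have ext₂ : ∀ X Y Z M : ℤ, (X ≤ M + 1 ∧ M ≤ X + 1) → (Y ≤ M + 1 ∧ M ≤ Y + 1) →
      (Z ≤ M + 1 ∧ M ≤ Z + 1) → ∀ a v w u c r p y' x' b : ℤ,
      ((X ≤ a + (i + 1) ∧ a ≤ X + (i + 1)) ∧ (v ≤ Y + (k + 1) ∧ Y ≤ v + (k + 1)) ∧
        (v ≤ w + 1 ∧ w ≤ v + 1 ∧ v ≤ u + 1 ∧ u ≤ v + 1 ∧ w ≤ u + 1 ∧ u ≤ w + 1) ∧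
        (r ≤ u + (i + 2) ∧ u ≤ r + (i + 2)) ∧
        (a ≤ x' + 1 ∧ x' ≤ a + 1 ∧ a ≤ b + 1 ∧ b ≤ a + 1 ∧ x' ≤ b + 1 ∧ b ≤ x' + 1) ∧
        (c ≤ y' + 1 ∧ y' ≤ c + 1 ∧ c ≤ b + 1 ∧ b ≤ c + 1 ∧ y' ≤ b + 1 ∧ b ≤ y' + 1) ∧
        (c ≤ p + (j + 1) ∧ p ≤ c + (j + 1))) →
      (Z ≤ r + 1 ∧ r ≤ Z + 1 ∧ Z ≤ p + 1 ∧ p ≤ Z + 1 ∧ r ≤ p + 1 ∧ p ≤ r + 1) →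
      ∃ f, IsPotential H₂ f ∧ f (n + 2) = w ∧ f (n + 7) = y' ∧ f (n + 8) = x' := by
    intro X Y Z M hX hY hZ a v w u c r p y' x' b hc hd
    obtain ⟨f, hf, hfv, h2, h5, h6, h7, h8⟩ := ext₁ _ (isPotential_three axy axz ayz hX hY hZ)
      a v w u c r p y' x' b (by simpa [nxy.symm] using hc)
    obtain ⟨f', hf', hfv'⟩ := e₂ f hf (by
      rw [hfv z hz, h5, h6]
      simpa [nxz.symm, nyz.symm] using hd)
    refine ⟨f', hf', ?_, ?_, ?_⟩ <;> rw [hfv' _ (by omega)] <;> assumption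
  refine ⟨H₂, ⟨?_, ?_, s₂.noCycle⟩, ?_, ?_, ?_⟩
  · convert s₂.real.rotate.swap using 1
    rw [hℓ, show 2 * i + j + k + 10 - 2 = 2 * i + j + k + 8 by omega]
    ring
  · rw [s₂.card, hℓ, show 2 * i + j + k + 10 - 1 = 2 * i + j + k + 9 by omega]
    ring
  -- From `x'` to `w`, the way through `p` and `r` has length `i + j + 7` and the way through `x`
  -- and `y` at least `i + k + 6`. The near equality of `i, j, k` keeps detours through `z` from
  -- being shorter than `i + k + 6`.
  · obtain ⟨f, hf, h2, h7, h8⟩ := ext₂ (i + 2) (i + 4) (j + 3) (i + 3) (by omega) (by omega)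
      (by omega) 1 (i + k + 5) (i + k + 6) (i + k + 5) 2 (j + 4) (j + 3) 1 0 1 (by omega)
      (by omega)
    exact ⟨f, hf, by rw [h2, h8]; push_cast; omega⟩
  -- From `y'` to `w`, the same two ways have lengths `i + j + 6` and at least `i + k + 7`.
  · obtain ⟨f, hf, h2, h7, h8⟩ := ext₂ (i + 3) (i + 5) (j + 3) (i + 4) (by omega) (by omega)
      (by omega) 2 (i + j + 5) (i + j + 6) (i + j + 5) 1 (j + 3) (j + 2) 0 1 1 (by omega)
      (by omega)
    exact ⟨f, hf, by rw [h2, h7]; push_cast; omega⟩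
  · obtain ⟨f, hf, h2, h7, h8⟩ := ext₂ 1 1 1 1 (by omega) (by omega)
      (by omega) 1 1 1 1 1 1 1 2 0 1 (by omega) (by omega)
    exact ⟨f, hf, by rw [h7, h8]; omega⟩

/-! ### Starting and iterating the layers -/

lemma realizable_triangle : Realizable 3 ⊥ [(0, 1, 2)] := by
  refine ⟨fun v => if v = 0 then (0, 0) else if v = 1 then (1, 0) else (0, 1), fun _ => 0, ?_, ?_,
    ?_, ?_⟩
  · intro v hv
    interval_cases v
    · refine ⟨(-1, -1, 0), fun w hw => ?_⟩
      interval_cases w <;> norm_num [affEval]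
    · refine ⟨(1, 0, -1), fun w hw => ?_⟩
      interval_cases w <;> norm_num [affEval]
    · refine ⟨(0, 1, -1), fun w hw => ?_⟩
      interval_cases w <;> norm_num [affEval]
  · intro u v h
    exact absurd h (by simp)
  · simp only [List.mem_singleton, forall_eq]
    refine ⟨by norm_num, by norm_num [cross], (0, 0, 0), fun w hw => ?_⟩
    interval_cases w <;> norm_num [affEval, triSet]
  · simp

lemma not_hasCycle_bot {ℓ : ℕ} : ¬ HasCycle (⊥ : SimpleGraph ℕ) ℓ := by
  rintro ⟨c, -, h, -⟩
  exact absurd (h 0) (by simp)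

/-- Two blocks with a common vertex start the construction. -/
lemma exists_isLayer_zero {ℓ t δ q : ℕ} (hp : IsBlockSize ℓ t δ q) (B C : ℕ) :
    ∃ H, IsLayer ℓ (6 + 2 * q) (2 * (3 * (q + 1))) B C H 0 2 3 := by
  have hR : Realizable 6 ⊥ [(5, 1, 2), (3, 5, 2), (3, 1, 5), (4, 1, 3), (0, 4, 3), (0, 1, 4),
      (0, 3, 2)] :=
    (((realizable_triangle.stack.bring 2 (by simp)).stack).bring 3 (by simp)).stack
  have hI : ∀ v, Isolated (⊥ : SimpleGraph ℕ) v := fun v u h => absurd h (by simp)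
  have s₀ : IsState ℓ 6 0 ⊥ _ := ⟨hR, by simp, not_hasCycle_bot⟩
  -- The blocks on `5 1 2` and `0 1 4` share only the vertex 1, so 0 and 2 are at distance 2. The
  -- corner 3 stays isolated, which makes `B` and `C` arbitrary.
  obtain ⟨H₁, s₁, i₁, e₁⟩ := s₀.addBlock hp (apart_of_isolated _ (by omega) (hI _))
    (apart_of_isolated _ (by omega) (hI _)) (apart_of_isolated _ (by omega) (hI _))
  have hI₁ : ∀ v, v = 0 ∨ v = 3 ∨ v = 4 → Isolated H₁ v := fun v hv =>
    i₁ v (by omega) (by omega) (by omega) (by omega) (hI v)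
  obtain ⟨H₂, s₂, i₂, e₂⟩ := (s₁.bring 4 (by simp)).addBlock hp
    (apart_of_isolated _ (by omega) (hI₁ 0 (by omega))).symm
    (apart_of_isolated _ (by omega) (hI₁ 4 (by omega)))
    (apart_of_isolated _ (by omega) (hI₁ 4 (by omega)))
  have hI₂ : Isolated H₂ 3 :=
    i₂ 3 (by omega) (by omega) (by omega) (by omega) (hI₁ 3 (by omega))
  refine ⟨H₂, ⟨?_, ?_, s₂.noCycle⟩, apart_of_isolated _ (by omega) hI₂,
    apart_of_isolated _ (by omega) hI₂, ?_⟩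
  · have R := ((s₂.real.bring 4 (by simp)).mono (F' := [(0, 3, 2)])
      ((List.nil_sublist _).cons_cons _).subperm).swap.rotate
    convert R using 1
    ring
  · rw [s₂.card]; ring
  · obtain ⟨f₁, p₁, g₁⟩ := e₁ (fun v => if v = 0 then 0 else if v = 2 then 2 else 1)
      (fun u v h => absurd h (by simp)) (by norm_num)
    obtain ⟨f₂, p₂, g₂⟩ := e₂ f₁ p₁ (by
      rw [g₁ 0 (by omega), g₁ 1 (by omega), g₁ 4 (by omega)]; norm_num)
    refine ⟨f₂, p₂, ?_⟩
    rw [g₂ 0 (by omega), g₂ 2 (by omega), g₁ 0 (by omega), g₁ 2 (by omega)]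
    norm_num

lemma exists_isLayer {ℓ t δ q i j k : ℕ} (hp : IsBlockSize ℓ t δ q)
    (hℓ : ℓ = 2 * i + j + k + 10) (hij : i ≤ j) (hji : j ≤ i + 1) (hjk : j ≤ k) (hkj : k ≤ j + 1)
    (s : ℕ) : ∃ H x y z, IsLayer ℓ (6 + 2 * q + s * ((ℓ - 2) * (q + 2) + q))
      ((2 + (ℓ - 1) * s) * (3 * (q + 1))) (i + j + 5) (i + k + 5) H x y z := by
  induction s with
  | zero =>
    obtain ⟨H, h⟩ := exists_isLayer_zero hp (i + j + 5) (i + k + 5)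
    exact ⟨H, 0, 2, 3, by simpa using h⟩
  | succ s ih =>
    obtain ⟨H, x, y, z, h⟩ := ih
    obtain ⟨H', h'⟩ := h.next hp hℓ hij hji hjk hkj
    rw [show 6 + 2 * q + (s + 1) * ((ℓ - 2) * (q + 2) + q) =
        6 + 2 * q + s * ((ℓ - 2) * (q + 2) + q) + ((ℓ - 2) * (q + 2) + q) by ring,
      show (2 + (ℓ - 1) * (s + 1)) * (3 * (q + 1)) =
        (2 + (ℓ - 1) * s) * (3 * (q + 1)) + (ℓ - 1) * (3 * (q + 1)) by ring]
    exact ⟨H', _, _, _, h'⟩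

/-! ### Finite planar graphs and the count -/

lemma IsState.exists_planar {ℓ n m : ℕ} {H : SimpleGraph ℕ} {F : List (ℕ × ℕ × ℕ)} (hℓ : 2 ≤ ℓ)
    (hs : IsState ℓ n m H F) : ∃ G : SimpleGraph (Fin n), IsPlanarGraph G ∧
      (SimpleGraph.cycleGraph ℓ).Free G ∧ G.edgeSet.ncard = m := by
  refine ⟨H.comap Fin.val, ?_, ?_, ?_⟩
  · obtain ⟨P, h, hv, he, -, -⟩ := hs.real
    exact isPlanarGraph_of_supported hv _ fun u v huv => (he _ _ huv).2.2
  · exact fun hcon => hs.noCycle ((hasCycle_of_isContained hℓ hcon).map Fin.val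
      Fin.val_injective fun u v h => h)
  · rw [← hs.card, ← Set.ncard_image_of_injective _ (Sym2.map.injective Fin.val_injective)]
    congr 1
    ext e
    induction e with | _ u v
    rw [Set.mem_image]
    constructor
    · rintro ⟨e, he, heq⟩
      induction e with | _ a b
      rw [Sym2.map_mk] at heq
      rw [← heq]
      exact he
    · intro h
      obtain ⟨hu, hv⟩ := hs.real.lt h
      exact ⟨s(⟨u, hu⟩, ⟨v, hv⟩), h, rfl⟩

lemma le_planarTuranNumber {n : ℕ} {W : Type*} {K : SimpleGraph W} {G : SimpleGraph (Fin n)}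
    (hG : IsPlanarGraph G) (hK : K.Free G) : G.edgeSet.ncard ≤ planarTuranNumber n K := by
  classical
  rw [planarTuranNumber, ← SimpleGraph.coe_edgeFinset, Set.ncard_coe_finset]
  refine (Finset.le_sup (f := fun G : SimpleGraph (Fin n) => G.edgeFinset.card)
    (b := G) ?_).trans' ?_
  · exact Finset.mem_filter.2 ⟨Finset.mem_univ _, hG, hK⟩
  · apply le_of_eq
    congr!

/-- The construction with `5 κ - 1` layers. -/
lemma exists_planar_graph {ℓ t δ q : ℕ} (hℓ : 11 ≤ ℓ) (hp : IsBlockSize ℓ t δ q) {κ : ℕ}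
    (hκ : 0 < κ) : ∃ n : ℕ, κ ≤ n ∧
      (n : ℝ) = (2 + ((ℓ : ℝ) - 1) * (5 * κ - 1)) * (q + 3) - (ℓ + 1) * (5 * κ - 1) ∧
      ∃ G : SimpleGraph (Fin n), IsPlanarGraph G ∧ (SimpleGraph.cycleGraph ℓ).Free G ∧
        (G.edgeSet.ncard : ℝ) = (2 + ((ℓ : ℝ) - 1) * (5 * κ - 1)) * (3 * (q + 1)) := by
  -- This splits `ℓ - 10` as evenly as possible: `i + j` and `i + k` are the lower and upper halves
  -- of `ℓ` minus 5. Any number of layers would do; `5 * κ - 1` yields the stated orders.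
  obtain ⟨i, hi⟩ : ∃ i, i = (ℓ / 2 - 1) / 2 - 2 := ⟨_, rfl⟩
  obtain ⟨H, x, y, z, h⟩ := exists_isLayer (i := i) (j := ℓ / 2 - 5 - i)
    (k := ℓ - ℓ / 2 - 5 - i) hp (by omega) (by omega) (by omega) (by omega) (by omega) (5 * κ - 1)
  obtain ⟨G, hG, hfree, hcard⟩ := h.state.exists_planar (by omega)
  have c1 : ((5 * κ - 1 : ℕ) : ℝ) = 5 * κ - 1 := by
    rw [Nat.cast_sub (by omega)]; push_cast; ring
  have c2 : ((ℓ - 1 : ℕ) : ℝ) = ℓ - 1 := by rw [Nat.cast_sub (by omega)]; simp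
  have c3 : ((ℓ - 2 : ℕ) : ℝ) = ℓ - 2 := by rw [Nat.cast_sub (by omega)]; simp
  refine ⟨_, ?_, ?_, G, hG, hfree, ?_⟩
  · have h1 : 1 * 1 ≤ (ℓ - 2) * (q + 2) := Nat.mul_le_mul (by omega) (by omega)
    have h2 : (5 * κ - 1) * 1 ≤ (5 * κ - 1) * ((ℓ - 2) * (q + 2) + q) :=
      Nat.mul_le_mul le_rfl (by omega)
    omega
  · push_cast [c1, c3]; ring
  · rw [hcard]; push_cast [c1, c2]; ring

/-- The graphs of the construction, their numbers of edges, and the comparison with the conjectured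
bound, with the average degree expressed by the order of the blocks. -/
lemma exists_counterexample {ℓ t δ q : ℕ} (hℓ : 11 ≤ ℓ) (hp : IsBlockSize ℓ t δ q)
    (hq : ℓ < q + 4) {κ : ℕ} (hκ : 0 < κ) {a : ℝ}
    (ha : a = 3 * ((q : ℝ) + 1) * (ℓ - 1) / ((q + 2) * (ℓ - 1) - 2)) : ∃ n : ℕ, κ ≤ n ∧
      (n : ℝ) = (2 + ((ℓ : ℝ) - 1) * (5 * κ - 1)) * (q + 3) - (ℓ + 1) * (5 * κ - 1) ∧
      (∃ G : SimpleGraph (Fin n), IsPlanarGraph G ∧ (SimpleGraph.cycleGraph ℓ).Free G ∧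
        (G.edgeSet.ncard : ℝ) = a * (n - 2 * ((ℓ : ℝ) + 1) / (ℓ - 1))) ∧
      a * (n - 2 * ((ℓ : ℝ) + 1) / (ℓ - 1)) ≤ planarTuranNumber n (SimpleGraph.cycleGraph ℓ) ∧
      3 * ((ℓ : ℝ) - 1) / ℓ * n - 6 * ((ℓ : ℝ) + 1) / ℓ <
        a * (n - 2 * ((ℓ : ℝ) + 1) / (ℓ - 1)) := by
  obtain ⟨n, hκn, hn, G, hG, hfree, hcard⟩ := exists_planar_graph hℓ hp hκ
  have hL : (11 : ℝ) ≤ ℓ := by exact_mod_cast hℓ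
  have hQ : (ℓ : ℝ) < q + 4 := by exact_mod_cast hq
  have hK : (1 : ℝ) ≤ κ := by exact_mod_cast hκ
  have hL1 : (ℓ : ℝ) - 1 ≠ 0 := by linarith
  have hL0 : (ℓ : ℝ) ≠ 0 := by linarith
  have hD : 0 < ((q : ℝ) + 2) * (ℓ - 1) - 2 := by nlinarith
  -- The shift makes both sides proportional to the number of blocks, so the edge count is exactly
  -- `a` times the shifted order.
  have hdiff : (n : ℝ) - 2 * ((ℓ : ℝ) + 1) / (ℓ - 1) =
      (2 + ((ℓ : ℝ) - 1) * (5 * κ - 1)) * (((q + 2) * (ℓ - 1) - 2) / (ℓ - 1)) := by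
    rw [hn]; field_simp; ring
  have hN : 0 < 2 + ((ℓ : ℝ) - 1) * (5 * κ - 1) := by
    have := mul_pos (by linarith : 0 < (ℓ : ℝ) - 1) (by linarith : (0 : ℝ) < 5 * κ - 1)
    linarith
  have hpos : 0 < (n : ℝ) - 2 * ((ℓ : ℝ) + 1) / (ℓ - 1) := by
    rw [hdiff]
    exact mul_pos hN (div_pos hD (by linarith))
  have hedge : (G.edgeSet.ncard : ℝ) = a * (n - 2 * ((ℓ : ℝ) + 1) / (ℓ - 1)) := by
    rw [hcard, hdiff, ha]
    have := hD.ne'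
    generalize ((q : ℝ) + 2) * (ℓ - 1) - 2 = D at this ⊢
    field_simp
  refine ⟨n, hκn, hn, ⟨G, hG, hfree, hedge⟩, ?_, ?_⟩
  · rw [← hedge]
    exact_mod_cast le_planarTuranNumber hG hfree
  -- After clearing denominators this is `ℓ < q + 4`.
  · have hlt : 3 * ((ℓ : ℝ) - 1) / ℓ < a := by
      rw [ha, div_lt_div_iff₀ (by linarith) hD]
      nlinarith
    have := mul_lt_mul_of_pos_right hlt hpos
    have heq : 3 * ((ℓ : ℝ) - 1) / ℓ * n - 6 * ((ℓ : ℝ) + 1) / ℓ =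
        3 * ((ℓ : ℝ) - 1) / ℓ * (n - 2 * ((ℓ : ℝ) + 1) / (ℓ - 1)) := by
      field_simp; ring
    rwa [heq]

lemma isBlockSize_odd {t : ℕ} (ht : 5 ≤ t) : IsBlockSize (2 * t + 1) t 0 (3 * t - 7) :=
  ⟨by omega, by omega, by omega, by omega⟩

lemma isBlockSize_even {t : ℕ} (ht : 5 ≤ t) : IsBlockSize (2 * t + 2) t 1 (3 * t - 6) :=
  ⟨by omega, by omega, by omega, by omega⟩

theorem theorem2 (ℓ : ℕ) (hℓ : 11 ≤ ℓ) :
    (¬ ∃ N : ℕ, ∀ n : ℕ, N ≤ n →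
      (planarTuranNumber n (SimpleGraph.cycleGraph ℓ) : ℝ) ≤
        3 * ((ℓ : ℝ) - 1) / ℓ * n - 6 * ((ℓ : ℝ) + 1) / ℓ) ∧
    (Odd ℓ → ∀ k : ℕ, 0 < k → Even k →
      ∃ n : ℕ,
        (n : ℝ) = ((5 * (ℓ : ℝ) - 5) * (k / 2) - ℓ + 3) * (3 * ((ℓ : ℝ) - 1) / 2 - 5)
          - (5 * k - 4) ∧
        (∃ G : SimpleGraph (Fin n), IsPlanarGraph G ∧ (SimpleGraph.cycleGraph ℓ).Free G ∧
          (G.edgeSet.ncard : ℝ) =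
            9 * ((ℓ : ℝ) - 5) * (ℓ - 1) / ((3 * ℓ - 13) * (ℓ - 1) - 4)
              * (n - 2 * ((ℓ : ℝ) + 1) / (ℓ - 1))) ∧
        9 * ((ℓ : ℝ) - 5) * (ℓ - 1) / ((3 * ℓ - 13) * (ℓ - 1) - 4)
            * (n - 2 * ((ℓ : ℝ) + 1) / (ℓ - 1)) ≤
          planarTuranNumber n (SimpleGraph.cycleGraph ℓ) ∧
        3 * ((ℓ : ℝ) - 1) / ℓ * n - 6 * ((ℓ : ℝ) + 1) / ℓ <
          9 * ((ℓ : ℝ) - 5) * (ℓ - 1) / ((3 * ℓ - 13) * (ℓ - 1) - 4)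
            * (n - 2 * ((ℓ : ℝ) + 1) / (ℓ - 1))) ∧
    (Even ℓ → ∀ k : ℕ, 0 < k → Even k →
      ∃ n : ℕ,
        (n : ℝ) = ((5 * (ℓ : ℝ) - 5) * (k / 2) - ℓ + 3) * (3 * ((ℓ : ℝ) / 2 - 1) - 4)
          - (5 * k - 4) ∧
        (∃ G : SimpleGraph (Fin n), IsPlanarGraph G ∧ (SimpleGraph.cycleGraph ℓ).Free G ∧
          (G.edgeSet.ncard : ℝ) =
            3 * (3 * (ℓ : ℝ) - 16) * (ℓ - 1) / ((3 * ℓ - 14) * (ℓ - 1) - 4)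
              * (n - 2 * ((ℓ : ℝ) + 1) / (ℓ - 1))) ∧
        3 * (3 * (ℓ : ℝ) - 16) * (ℓ - 1) / ((3 * ℓ - 14) * (ℓ - 1) - 4)
            * (n - 2 * ((ℓ : ℝ) + 1) / (ℓ - 1)) ≤
          planarTuranNumber n (SimpleGraph.cycleGraph ℓ) ∧
        3 * ((ℓ : ℝ) - 1) / ℓ * n - 6 * ((ℓ : ℝ) + 1) / ℓ <
          3 * (3 * (ℓ : ℝ) - 16) * (ℓ - 1) / ((3 * ℓ - 14) * (ℓ - 1) - 4)
            * (n - 2 * ((ℓ : ℝ) + 1) / (ℓ - 1))) := by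
  refine ⟨?_, ?_, ?_⟩
  · rintro ⟨N, hN⟩
    -- For both parities `ℓ < q + 4` amounts to `t ≥ 5`; this is where `ℓ ≥ 11` is needed.
    obtain ⟨t, δ, q, hp, hq⟩ : ∃ t δ q, IsBlockSize ℓ t δ q ∧ ℓ < q + 4 := by
      rcases Nat.even_or_odd' ℓ with ⟨c, rfl | rfl⟩
      · obtain ⟨t, rfl⟩ : ∃ t, c = t + 1 := ⟨c - 1, by omega⟩
        exact ⟨t, 1, _, isBlockSize_even (by omega), by omega⟩
      · exact ⟨c, 0, _, isBlockSize_odd (by omega), by omega⟩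
    obtain ⟨n, hn, -, -, h1, h2⟩ := exists_counterexample hℓ hp hq (Nat.succ_pos N) rfl
    exact absurd (hN n (by omega)) (not_le.2 (h2.trans_le h1))
  · rintro ⟨t, rfl⟩ k hk ⟨κ, rfl⟩
    have hc : ((3 * t - 7 : ℕ) : ℝ) = 3 * t - 7 := by rw [Nat.cast_sub (by omega)]; push_cast; ring
    have ht : (5 : ℝ) ≤ t := by exact_mod_cast (by omega : 5 ≤ t)
    obtain ⟨n, -, hn, h⟩ := exists_counterexample hℓ (isBlockSize_odd (by omega)) (by omega)
      (by omega : 0 < κ) (a := 9 * (((2 * t + 1 : ℕ) : ℝ) - 5) * ((2 * t + 1 : ℕ) - 1) /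
        ((3 * (2 * t + 1 : ℕ) - 13) * ((2 * t + 1 : ℕ) - 1) - 4)) (by
        rw [hc]
        push_cast
        rw [div_eq_div_iff (by nlinarith) (by nlinarith)]
        ring)
    refine ⟨n, ?_, h⟩
    rw [hn, hc]
    push_cast
    ring
  · rintro ⟨c, rfl⟩ k hk ⟨κ, rfl⟩
    obtain ⟨t, rfl⟩ : ∃ t, c = t + 1 := ⟨c - 1, by omega⟩
    rw [show t + 1 + (t + 1) = 2 * t + 2 by ring] at hℓ ⊢
    have hc : ((3 * t - 6 : ℕ) : ℝ) = 3 * t - 6 := by rw [Nat.cast_sub (by omega)]; push_cast; ring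
    have ht : (5 : ℝ) ≤ t := by exact_mod_cast (by omega : 5 ≤ t)
    obtain ⟨n, -, hn, h⟩ := exists_counterexample hℓ (isBlockSize_even (by omega)) (by omega)
      (by omega : 0 < κ) (a := 3 * (3 * ((2 * t + 2 : ℕ) : ℝ) - 16) * ((2 * t + 2 : ℕ) - 1) /
        ((3 * (2 * t + 2 : ℕ) - 14) * ((2 * t + 2 : ℕ) - 1) - 4)) (by
        rw [hc]
        push_cast
        rw [div_eq_div_iff (by nlinarith) (by nlinarith)]
        ring)
    refine ⟨n, ?_, h⟩
    rw [hn, hc]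
    push_cast
    ring
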